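/- Let $V=\{1,\dots,n\}$. A function $f:2^V\to\mathbb R$ is a \emph{positive polymatroid} if $f(\emptyset)=0$, $f(A)\le f(B)$ whenever $A\subseteq B\subseteq V$, $f(A)+f(B)\ge f(A\cup B)+f(A\cap B)$ for all $A,B\subseteq V$, and $f(A)>0$ for all $A\ne\emptyset$. The \emph{unconstrained heterogeneous SH-min} problem is: given sets $B_1,\dots,B_m\subseteq V$ and positive polymatroids $f_1,\dots,f_m$ on $V$ (possibly all different), find $A\subseteq V$ that minimizes $$F(A)=\sum_{i=1}^m f_i(A\,\triangle\,B_i).$$ The sets $B_i$ are given explicitly, and the functions $f_i$ are given by value oracles. \textbf{Theorem.} (1) Unconstrained heterogeneous SH-min is NP-hard. That is, for every language $L\in\mathrm{NP}$ over $\{0,1\}$ there is a map taking each string $x$ to an input $(n,m,(B_i)_{i\le m},(f_i)_{i\le m})$ with functions $f_i:2^V\to\mathbb N$ and a threshold $t\in\mathbb N$ such that: $n$, $m$ (in unary), the $B_i$ and $t$ (in binary) are computed from $x$ in polynomial time; the value $f_i(Y)$ (in binary) is computed from $x$, $i$ and $Y\subseteq V$ in polynomial time; and $x\in L$ if and only if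 $\min_{A\subseteq V}F(A)\le t$. (2) No polynomial-time algorithm in the value-oracle model achieves an approximation factor better than $4/3$ for unconstrained heterogeneous SH-min. More precisely, let $\alpha<4/3$ and $p>0$ be constants. There is no (possibly randomized) algorithm that, knowing $n$, $m$ and the sets $B_i$, and asking for values $f_i(Y)$ and $F(A)$ of its choice, makes a number of value queries that is bounded by a polynomial in the size of the input, and on every input outputs, with probability at least $p$, a set $A$ with $F(A)\le\alpha\cdot\min_{A'\subseteq V}F(A')$. This holds even if all $f_i$ take values in $\mathbb N$ and the size of the input is taken to be $n+m$ plus the total number of bits of the numbers $f_i(V)$, and it needs no complexity-theoretic assumption. -/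

import Mathlib

namespace SHMin

/-! ### Positive polymatroids and the problem SH-min -/

/-- A positive polymatroid function on the subsets of `V`: normalized, monotone, submodular,
and positive on every nonempty set. -/
structure IsPositivePolymatroid {V : Type*} [DecidableEq V] (f : Finset V → ℝ) : Prop where
  normalized : f ∅ = 0
  monotone : ∀ A B : Finset V, A ⊆ B → f A ≤ f B
  submodular : ∀ A B : Finset V, f (A ∪ B) + f (A ∩ B) ≤ f A + f B
  positive : ∀ A : Finset V, A ≠ ∅ → 0 < f A

/-- An input of unconstrained heterogeneous SH-min over the ground set `Fin n`: positive
polymatroid functions `f i`, which may all be distinct, and sets `B i`, for `i : Fin m`.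
Only functions with values in `ℕ` are considered: a hardness result for these inputs is the
stronger one. -/
structure Input where
  n : ℕ
  m : ℕ
  B : Fin m → Finset (Fin n)
  f : Fin m → Finset (Fin n) → ℕ
  polymatroid : ∀ i, IsPositivePolymatroid fun Y => (f i Y : ℝ)

/-- The objective function `F(A) = ∑ i, f i (A ∆ B i)`, to be minimized over all `A`. -/
def Input.objective (I : Input) (A : Finset (Fin I.n)) : ℕ :=
  ∑ i, I.f i (symmDiff A (I.B i))

/-! ### NP-hardness

Polynomial time is that of multi-stack Turing machines, with Mathlib's step count. -/

open Computability in
/-- The class NP of languages over `{0, 1}`: there are a polynomial `p` and a verifier `V` that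
runs in polynomial time, such that `x` lies in `L` if and only if `V` accepts `(x, y)` for some
string `y` of length at most `p(|x|)`. -/
def InNP (L : Set (List Bool)) : Prop :=
  ∃ (p : Polynomial ℕ) (V : List Bool × List Bool → Bool),
    Nonempty (Turing.TM2ComputableInPolyTime
      (encodingProd (encodingList Bool) (encodingList Bool)).encode encodeBool V) ∧
    ∀ x, x ∈ L ↔ ∃ y : List Bool, y.length ≤ p.eval x.length ∧ V (x, y) = true

/-- The characteristic vector of a subset of `Fin n`, as a string of `n` bits. -/
def charVec {n : ℕ} (Y : Finset (Fin n)) : List Bool :=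
  List.ofFn fun j => decide (j ∈ Y)

open Computability in
/-- The string that describes the explicit part of an input of the decision problem
"is there an `A` with `F(A) ≤ t`": the numbers `n` and `m` in unary, the characteristic vectors of
the sets `B i` one after the other, and the threshold `t` in binary. -/
def explicitPart (I : Input) (t : ℕ) : List (Bool ⊕ (Bool ⊕ (Bool ⊕ Bool))) :=
  (encodingProd unaryEncodingNat
    (encodingProd unaryEncodingNat (encodingProd (encodingList Bool) encodingNatBool))).encode
    (I.n, I.m, (List.ofFn fun i => charVec (I.B i)).flatten, t)

open Computability in
/-- The string that describes a value query `f i (Y)` to the input that belongs to `x`: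
the string `x`, the index `i` in binary, and the characteristic vector of `Y`. -/
def queryString (x : List Bool) {n m : ℕ} (i : Fin m) (Y : Finset (Fin n)) :
    List (Bool ⊕ (Bool ⊕ Bool)) :=
  (encodingProd (encodingList Bool) (encodingProd encodingNatBool (encodingList Bool))).encode
    (x, (i : ℕ), charVec Y)

open Computability in
/-- A polynomial-time reduction of the language `L` to (the decision version of) SH-min, whose
functions are given by value oracles. It maps `x` to an input `I x` and a threshold `t x` so that
`x ∈ L` if and only if some set has objective value at most `t x`. The explicit part of the input
is computed in polynomial time from `x`, and the value oracles can be answered in polynomial time: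
`f i (Y)` is computed in polynomial time from `x`, `i` and `Y`. -/
def ReducesToSHMin (L : Set (List Bool)) : Prop :=
  ∃ (I : List Bool → Input) (t : List Bool → ℕ),
    Nonempty (Turing.TM2ComputableInPolyTime
      (id : List Bool → List Bool) (id : List _ → List _) fun x => explicitPart (I x) (t x)) ∧
    Nonempty (Turing.TM2ComputableInPolyTime
      (fun q : (x : List Bool) × Fin (I x).m × Finset (Fin (I x).n) =>
        queryString q.1 q.2.1 q.2.2)
      encodeNat
      fun q => (I q.1).f q.2.1 q.2.2) ∧
    ∀ x, x ∈ L ↔ ∃ A, (I x).objective A ≤ t x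

/-- SH-min (unconstrained, heterogeneous) is NP-hard. -/
def IsNPHard : Prop :=
  ∀ L : Set (List Bool), InNP L → ReducesToSHMin L

/-! ### Algorithms in the value-oracle model -/

/-- The run of a (randomized) algorithm in the value-oracle model, on a ground set `Fin n` and
with `m` functions, as a decision tree. The algorithm may ask for a value `f i (Y)`, ask for a
value `F(A)`, toss a fair coin, or stop with an output. What it does next may depend in any way on
the answers so far. -/
inductive Run (n m : ℕ) : Type
  | output (A : Finset (Fin n)) : Run n m
  | askTerm (i : Fin m) (Y : Finset (Fin n)) (next : ℕ → Run n m) : Run n m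
  | askObjective (A : Finset (Fin n)) (next : ℕ → Run n m) : Run n m
  | coin (next : Bool → Run n m) : Run n m

/-- The number of value queries on the input `I`, for the worst outcome of the coins. -/
def Run.queries (I : Input) : Run I.n I.m → ℕ
  | .output _ => 0
  | .askTerm i Y next => (next (I.f i Y)).queries I + 1
  | .askObjective A next => (next (I.objective A)).queries I + 1
  | .coin next => max ((next true).queries I) ((next false).queries I)

open Classical in
/-- The probability that the output on the input `I` has the property `good`. -/
noncomputable def Run.prob (I : Input) (good : Finset (Fin I.n) → Prop) : Run I.n I.m → ℝ
  | .output A => if good A then 1 else 0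
  | .askTerm i Y next => (next (I.f i Y)).prob I good
  | .askObjective A next => (next (I.objective A)).prob I good
  | .coin next => ((next true).prob I good + (next false).prob I good) / 2

/-- An algorithm for SH-min in the value-oracle model. It knows `n`, `m` and the sets `B i`,
and has access to the functions through value queries only. -/
def Algorithm : Type :=
  (n m : ℕ) → (Fin m → Finset (Fin n)) → Run n m

/-- The size of an input: `n + m` plus the number of bits of the largest value of each function
(by monotonicity, its value at the full ground set). -/
def Input.size (I : Input) : ℕ :=
  I.n + I.m + ∑ i, Nat.size (I.f i Finset.univ)

/-- The algorithm asks at most polynomially many value queries in the size of the input. Every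
algorithm that runs in polynomial time has this property. -/
def Algorithm.PolynomiallyManyQueries (alg : Algorithm) : Prop :=
  ∃ q : Polynomial ℕ, ∀ I : Input, (alg I.n I.m I.B).queries I ≤ q.eval I.size

/-- On every input, with probability at least `p`, the algorithm outputs a set whose objective
value is at most `α` times the minimum. -/
def Algorithm.Approximates (alg : Algorithm) (α p : ℝ) : Prop :=
  ∀ I : Input,
    p ≤ (alg I.n I.m I.B).prob I fun A => ∀ A', (I.objective A : ℝ) ≤ α * I.objective A'

end SHMin

/-!
Both parts use inputs with three functions on a ground set of `k` pairs (`pairInput`). A weighted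
pair-coverage function is applied to `A` and to the complement of `A`; together these two terms are
a constant plus the weights of the pairs that `A` splits. The third function `g` is applied to the
symmetric difference of `A` with the set of first elements, which is a transversal of the pairs if
`A` splits none. Minimization therefore amounts to minimizing `g` over the `2 ^ k` transversals, and
`g` may be very different on different transversals.

For NP-hardness, the weights are so large that no pair can be split below the threshold. The
function `g` is `2 ^ (n + 1) - 2 ^ (n - |Y| + 1)`, increased by one at the nonempty sets whose
second elements spell a certificate that the verifier rejects. The concave function is strict enough
to absorb arbitrary increases by one (`isPositivePolymatroid_concaveVal`), so that `g` is a
polymatroid no matter what the verifier does, and the threshold is met if and only if some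
certificate is accepted (`exists_objective_le_threshold_iff`). It remains to show that the input can
be computed by multi-stack machines in polynomial time. For this there is a small language of
structured programs (`Prog`) with composition, branching, loops over a stack, and subroutines; its
programs are machines (`Prog.nonempty_computable`). The weights and the values of `g` are chosen
such that all numbers can be written down bit by bit without arithmetic: they are binary words of
the form `1…10…0`, up to the last bit, and bits of disjunctions followed by zeros. The explicit part
of the input is written by `exists_prog_explicitWord`, and the value queries are answered by
`oracleProg_runs`, which calls the verifier.

For the approximation bound, all weights are one, and `g` is the rank function of the uniform
matroid of rank `k` in which, in addition, only `b` elements of a hidden random transversal are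
independent, where `b` is slightly larger than `k / 2`. A fixed set has to contain many more elements of
the hidden transversal than of its complement in order to distinguish this function from the rank
function of the uniform matroid, and Chernoff's bound shows that this has exponentially small
probability (`card_hiddenRank_ne_le`). As long as no query distinguishes the two, the algorithm
behaves as it does on the uniform matroid, hence polynomially many queries find nothing, except with
a vanishing probability (`Run.sum_prob_le`). But on the uniform matroid all values are at least
`2 * k` (`two_mul_le_objective_uniformRank`), whereas the hidden transversal has the value `k + b`,
and `2 * k / (k + b)` approaches `4 / 3`.
-/

namespace SHMin

/-! ### Ground sets that are divided into pairs -/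

/-- The first element of the `j`-th pair. -/
def pairFst {k : ℕ} (j : Fin k) : Fin (k * 2) := ⟨j * 2, by omega⟩

/-- The second element of the `j`-th pair. -/
def pairSnd {k : ℕ} (j : Fin k) : Fin (k * 2) := ⟨j * 2 + 1, by omega⟩

theorem eq_pairFst_or_eq_pairSnd {k : ℕ} (e : Fin (k * 2)) :
    ∃ j : Fin k, e = pairFst j ∨ e = pairSnd j := by
  refine ⟨⟨e / 2, by omega⟩, ?_⟩
  simp only [pairFst, pairSnd, Fin.ext_iff]
  omega

@[simp] theorem pairFst_inj {k : ℕ} {i j : Fin k} : pairFst i = pairFst j ↔ i = j := by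
  simp only [pairFst, Fin.ext_iff]; omega

@[simp] theorem pairSnd_inj {k : ℕ} {i j : Fin k} : pairSnd i = pairSnd j ↔ i = j := by
  simp only [pairSnd, Fin.ext_iff]; omega

@[simp] theorem pairFst_ne_pairSnd {k : ℕ} (i j : Fin k) : pairFst i ≠ pairSnd j := by
  simp only [pairFst, pairSnd, ne_eq, Fin.ext_iff]; omega

@[simp] theorem pairSnd_ne_pairFst {k : ℕ} (i j : Fin k) : pairSnd i ≠ pairFst j :=
  (pairFst_ne_pairSnd j i).symm

/-- The first elements of all pairs. -/
def firsts (k : ℕ) : Finset (Fin (k * 2)) := Finset.univ.image pairFst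

@[simp] theorem pairFst_mem_firsts {k : ℕ} (j : Fin k) : pairFst j ∈ firsts k := by
  simp [firsts]

@[simp] theorem pairSnd_notMem_firsts {k : ℕ} (j : Fin k) : pairSnd j ∉ firsts k := by
  simp [firsts]

theorem sum_pairs {k : ℕ} {M : Type*} [AddCommMonoid M] (f : Fin (k * 2) → M) :
    ∑ e, f e = ∑ j : Fin k, (f (pairFst j) + f (pairSnd j)) := by
  rw [← (finProdFinEquiv (m := k) (n := 2)).sum_comp, Fintype.sum_prod_type]
  refine Finset.sum_congr rfl fun j _ => ?_
  rw [Fin.sum_univ_two]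
  congr 2 <;> ext <;> simp [finProdFinEquiv, pairFst, pairSnd] <;> ring

theorem card_eq_sum_pairs {k : ℕ} (Y : Finset (Fin (k * 2))) :
    Y.card = ∑ j : Fin k, ((if pairFst j ∈ Y then 1 else 0) + if pairSnd j ∈ Y then 1 else 0) := by
  rw [← sum_pairs fun e => if e ∈ Y then 1 else 0]
  simp

/-- The transversal of the pairs that contains the second element of the `j`-th pair if `r j`
holds, and the first element otherwise. -/
def transversal {k : ℕ} (r : Fin k → Bool) : Finset (Fin (k * 2)) :=
  Finset.univ.image fun j => if r j then pairSnd j else pairFst j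

@[simp] theorem pairFst_mem_transversal {k : ℕ} (r : Fin k → Bool) (j : Fin k) :
    pairFst j ∈ transversal r ↔ r j = false := by
  simp only [transversal, Finset.mem_image, Finset.mem_univ, true_and]
  constructor
  · rintro ⟨i, hi⟩
    cases h : r i <;> simp [h] at hi
    rwa [← hi]
  · intro h
    exact ⟨j, by simp [h]⟩

@[simp] theorem pairSnd_mem_transversal {k : ℕ} (r : Fin k → Bool) (j : Fin k) :
    pairSnd j ∈ transversal r ↔ r j = true := by
  simp only [transversal, Finset.mem_image, Finset.mem_univ, true_and]
  constructor
  · rintro ⟨i, hi⟩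
    cases h : r i <;> simp [h] at hi
    rwa [← hi]
  · intro h
    exact ⟨j, by simp [h]⟩

theorem card_transversal {k : ℕ} (r : Fin k → Bool) : (transversal r).card = k := by
  rw [card_eq_sum_pairs]
  simp only [pairFst_mem_transversal, pairSnd_mem_transversal]
  rw [Finset.sum_congr rfl (g := fun _ => 1) (fun j _ => by cases r j <;> simp)]
  simp

/-! ### Positive polymatroids from counts and from coverage -/

theorem IsPositivePolymatroid.of_nat {V : Type*} [DecidableEq V] {f : Finset V → ℕ}
    (h0 : f ∅ = 0) (hmono : ∀ A B, A ⊆ B → f A ≤ f B)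
    (hsub : ∀ A B, f (A ∪ B) + f (A ∩ B) ≤ f A + f B) (hpos : ∀ A, A ≠ ∅ → 0 < f A) :
    IsPositivePolymatroid fun Y => (f Y : ℝ) where
  normalized := by simp [h0]
  monotone A B h := by exact_mod_cast hmono A B h
  submodular A B := by exact_mod_cast hsub A B
  positive A h := by exact_mod_cast hpos A h

/-- The total weight of the pairs that `Y` meets. -/
def touchWeight {k : ℕ} (c : Fin k → ℕ) (Y : Finset (Fin (k * 2))) : ℕ :=
  ∑ j, if pairFst j ∈ Y ∨ pairSnd j ∈ Y then c j else 0

theorem isPositivePolymatroid_touchWeight {k : ℕ} {c : Fin k → ℕ} (hc : ∀ j, 0 < c j) :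
    IsPositivePolymatroid fun Y => (touchWeight c Y : ℝ) := by
  refine .of_nat (by simp [touchWeight]) (fun A B h => ?_) (fun A B => ?_) (fun A hA => ?_)
  · refine Finset.sum_le_sum fun j _ => ?_
    have h1 := @h (pairFst j)
    have h2 := @h (pairSnd j)
    split_ifs <;> first | omega | tauto
  · simp only [touchWeight, ← Finset.sum_add_distrib]
    refine Finset.sum_le_sum fun j _ => ?_
    simp only [Finset.mem_union, Finset.mem_inter]
    split_ifs <;> first | omega | tauto
  · obtain ⟨e, he⟩ := Finset.nonempty_iff_ne_empty.2 hA
    obtain ⟨j, hj⟩ := eq_pairFst_or_eq_pairSnd e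
    refine Finset.sum_pos' (fun _ _ => Nat.zero_le _) ⟨j, Finset.mem_univ _, ?_⟩
    rw [if_pos (by rcases hj with rfl | rfl <;> simp [he])]
    exact hc j

/-- The set `A` contains both or neither of the elements of the `j`-th pair. -/
def Respects {k : ℕ} (A : Finset (Fin (k * 2))) (j : Fin k) : Prop :=
  pairFst j ∈ A ↔ pairSnd j ∈ A

instance {k : ℕ} (A : Finset (Fin (k * 2))) : DecidablePred (Respects A) :=
  fun _ => inferInstanceAs (Decidable (_ ↔ _))

theorem touchWeight_add_touchWeight_symmDiff_univ {k : ℕ} (c : Fin k → ℕ)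
    (A : Finset (Fin (k * 2))) :
    touchWeight c (symmDiff A ∅) + touchWeight c (symmDiff A Finset.univ) =
      ∑ j, c j + ∑ j, if Respects A j then 0 else c j := by
  simp only [touchWeight, ← Finset.sum_add_distrib]
  refine Finset.sum_congr rfl fun j _ => ?_
  by_cases h1 : pairFst j ∈ A <;> by_cases h2 : pairSnd j ∈ A <;>
    simp [h1, h2, Respects, Finset.mem_symmDiff]

/-- The input in which two copies of a weighted pair-coverage function, applied to a set and to
its complement, make it expensive to split a pair, and `g` is applied to the symmetric difference
with the set of first elements. For a set that splits no pair, this difference is a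
transversal. -/
def pairInput (k : ℕ) (c : Fin k → ℕ) (hc : ∀ j, 0 < c j) (g : Finset (Fin (k * 2)) → ℕ)
    (hg : IsPositivePolymatroid fun Y => (g Y : ℝ)) : Input where
  n := k * 2
  m := 3
  B := ![∅, Finset.univ, firsts k]
  f := ![touchWeight c, touchWeight c, g]
  polymatroid i := by
    fin_cases i
    · exact isPositivePolymatroid_touchWeight hc
    · exact isPositivePolymatroid_touchWeight hc
    · exact hg

theorem objective_pairInput {k : ℕ} {c : Fin k → ℕ} {hc : ∀ j, 0 < c j}
    {g : Finset (Fin (k * 2)) → ℕ} {hg : IsPositivePolymatroid fun Y => (g Y : ℝ)}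
    (A : Finset (Fin (k * 2))) :
    (pairInput k c hc g hg).objective A =
      ∑ j, c j + (∑ j, if Respects A j then 0 else c j) + g (symmDiff A (firsts k)) := by
  rw [← touchWeight_add_touchWeight_symmDiff_univ]
  exact Fin.sum_univ_three
    fun i => (pairInput k c hc g hg).f i (symmDiff A ((pairInput k c hc g hg).B i))

theorem objective_pairInput_congr {k : ℕ} {c : Fin k → ℕ} {hc : ∀ j, 0 < c j}
    {g g' : Finset (Fin (k * 2)) → ℕ} {hg : IsPositivePolymatroid fun Y => (g Y : ℝ)}
    {hg' : IsPositivePolymatroid fun Y => (g' Y : ℝ)} {A : Finset (Fin (k * 2))}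
    (h : g (symmDiff A (firsts k)) = g' (symmDiff A (firsts k))) :
    (pairInput k c hc g hg).objective A = (pairInput k c hc g' hg').objective A := by
  refine (objective_pairInput A).trans (Eq.trans ?_ (objective_pairInput A).symm)
  rw [h]

/-- The sets that split no pair correspond to the transversals. -/
theorem symmDiff_firsts_of_respects {k : ℕ} {A : Finset (Fin (k * 2))} (h : ∀ j, Respects A j) :
    symmDiff A (firsts k) = transversal fun j => decide (pairSnd j ∈ A) := by
  ext e
  obtain ⟨j, rfl | rfl⟩ := eq_pairFst_or_eq_pairSnd e
  · have := h j
    simp_all [Finset.mem_symmDiff, Respects]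
  · simp [Finset.mem_symmDiff]

theorem respects_symmDiff_transversal_firsts {k : ℕ} (r : Fin k → Bool) (j : Fin k) :
    Respects (symmDiff (transversal r) (firsts k)) j := by
  cases h : r j <;> simp [Respects, Finset.mem_symmDiff, h]

/-- The objective value of the set that belongs to the transversal `r`. -/
theorem objective_transversal {k : ℕ} {c : Fin k → ℕ} {hc : ∀ j, 0 < c j}
    {g : Finset (Fin (k * 2)) → ℕ} {hg : IsPositivePolymatroid fun Y => (g Y : ℝ)}
    (r : Fin k → Bool) :
    (pairInput k c hc g hg).objective (symmDiff (transversal r) (firsts k)) =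
      ∑ j, c j + g (transversal r) := by
  have h : ∀ A : Finset (Fin (k * 2)), A = symmDiff (transversal r) (firsts k) →
      ∑ j, c j + (∑ j, if Respects A j then 0 else c j) + g (symmDiff A (firsts k)) =
        ∑ j, c j + g (transversal r) := by
    rintro A rfl
    rw [symmDiff_symmDiff_cancel_right]
    simp [respects_symmDiff_transversal_firsts]
  exact (objective_pairInput (k := k) _).trans (h _ rfl)

/-! ### Hidden transversals -/

/-- The rank function of the uniform matroid of rank `k`. -/
def uniformRank {k : ℕ} (Y : Finset (Fin (k * 2))) : ℕ := min k Y.card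

/-- The rank function of the matroid in which, in addition, at most `b` elements of the
transversal `r` are independent. -/
def hiddenRank {k : ℕ} (b : ℕ) (r : Fin k → Bool) (Y : Finset (Fin (k * 2))) : ℕ :=
  min k ((Y \ transversal r).card + min (Y ∩ transversal r).card b)

theorem isPositivePolymatroid_hiddenRank {k b : ℕ} (hb : 0 < b) (hk : 0 < k) (r : Fin k → Bool) :
    IsPositivePolymatroid fun Y => (hiddenRank b r Y : ℝ) := by
  have mono : ∀ A B : Finset (Fin (k * 2)), A ⊆ B →
      (A \ transversal r).card ≤ (B \ transversal r).card ∧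
      (A ∩ transversal r).card ≤ (B ∩ transversal r).card := fun A B h =>
    ⟨Finset.card_le_card (Finset.sdiff_subset_sdiff h (Finset.Subset.refl _)),
      Finset.card_le_card (Finset.inter_subset_inter h (Finset.Subset.refl _))⟩
  refine .of_nat (by simp [hiddenRank]) (fun A B h => ?_) (fun A B => ?_) (fun A hA => ?_)
  · have := mono A B h
    unfold hiddenRank
    omega
  · have h1 := Finset.card_union_add_card_inter (A \ transversal r) (B \ transversal r)
    have h2 := Finset.card_union_add_card_inter (A ∩ transversal r) (B ∩ transversal r)
    have h0 : (A \ transversal r) ∩ (B \ transversal r) = (A ∩ B) \ transversal r := by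
      ext
      simp only [Finset.mem_inter, Finset.mem_sdiff]
      tauto
    rw [← Finset.union_sdiff_distrib, h0] at h1
    rw [← Finset.union_inter_distrib_right, ← Finset.inter_inter_distrib_right] at h2
    have h3 := mono A (A ∪ B) Finset.subset_union_left
    have h4 := mono B (A ∪ B) Finset.subset_union_right
    have h5 := mono (A ∩ B) A Finset.inter_subset_left
    have h6 := mono (A ∩ B) B Finset.inter_subset_right
    unfold hiddenRank
    omega
  · have h1 := Finset.card_sdiff_add_card_inter A (transversal r)
    have h2 := Finset.card_pos.2 (Finset.nonempty_iff_ne_empty.2 hA)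
    unfold hiddenRank
    omega

theorem hiddenRank_self {k b : ℕ} (h : b ≤ k) (r : Fin k → Bool) :
    hiddenRank b r (transversal r) = b := by
  simp [hiddenRank, card_transversal, h]

theorem isPositivePolymatroid_uniformRank {k : ℕ} (hk : 0 < k) :
    IsPositivePolymatroid fun Y : Finset (Fin (k * 2)) => (uniformRank Y : ℝ) := by
  -- With room for `2k` elements of the transversal there is no additional constraint.
  have h : ∀ Y : Finset (Fin (k * 2)), uniformRank Y = hiddenRank (k * 2) (fun _ => true) Y := by
    intro Y
    have h1 := Finset.card_sdiff_add_card_inter Y (transversal fun _ => true)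
    have h2 := Finset.card_le_univ (Y ∩ transversal fun _ => true)
    rw [Fintype.card_fin] at h2
    unfold hiddenRank uniformRank
    omega
  simp only [h]
  exact isPositivePolymatroid_hiddenRank (by omega) hk _

theorem card_inter_sub_card_sdiff_transversal {k : ℕ} (r : Fin k → Bool)
    (Y : Finset (Fin (k * 2))) :
    ((Y ∩ transversal r).card : ℝ) - (Y \ transversal r).card =
      ∑ j, (if r j then (1 : ℝ) else -1) *
        ((if pairSnd j ∈ Y then 1 else 0) - if pairFst j ∈ Y then 1 else 0) := by
  rw [card_eq_sum_pairs, card_eq_sum_pairs]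
  push_cast
  rw [← Finset.sum_sub_distrib]
  refine Finset.sum_congr rfl fun j _ => ?_
  by_cases h1 : pairFst j ∈ Y <;> by_cases h2 : pairSnd j ∈ Y <;> cases h : r j <;> simp [*]

/-- The moment generating function of a sum of independent random signs. -/
theorem sum_exp_signs {k : ℕ} (d : Fin k → ℝ) :
    ∑ r : Fin k → Bool, Real.exp (∑ j, (if r j then (1 : ℝ) else -1) * d j) =
      ∏ j, (2 * Real.cosh (d j)) := by
  have h : ∀ j, 2 * Real.cosh (d j) =
      ∑ s : Bool, Real.exp ((if s then (1 : ℝ) else -1) * d j) := by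
    intro j
    rw [Fintype.sum_bool, Real.cosh_eq]
    simp only [if_true, Bool.false_eq_true, if_false]
    ring_nf
  simp only [h, Finset.prod_univ_sum, Fintype.piFinset_univ, Real.exp_sum]

/-- A fixed set distinguishes only an exponentially small fraction of the hidden transversals from
the uniform matroid: it does so only if the number of its elements on the transversal exceeds the
number of its other elements by `2 * b - k`, which Chernoff's method bounds. -/
theorem card_hiddenRank_ne_le {k b : ℕ} {ε : ℝ} (hε : 0 ≤ ε) (hb : k * ε ≤ 2 * b - k)
    (Y : Finset (Fin (k * 2))) :
    ((Finset.univ.filter fun r : Fin k → Bool => hiddenRank b r Y ≠ uniformRank Y).card : ℝ) ≤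
      2 ^ k * Real.exp (-(k * ε ^ 2 / 2)) := by
  set d : Fin k → ℝ := fun j =>
    (if pairSnd j ∈ Y then 1 else 0) - if pairFst j ∈ Y then 1 else 0 with hd
  have hd1 : ∀ j, d j ^ 2 ≤ 1 := fun j => by
    simp only [hd]
    split_ifs <;> norm_num
  have key : ∀ r : Fin k → Bool, hiddenRank b r Y ≠ uniformRank Y →
      1 ≤ Real.exp (∑ j, (if r j then (1 : ℝ) else -1) * (ε * d j)) *
        Real.exp (-(k * ε ^ 2)) := by
    intro r hr
    have h1 := Finset.card_sdiff_add_card_inter Y (transversal r)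
    have h2 : 2 * b + (Y \ transversal r).card ≤ k + (Y ∩ transversal r).card := by
      unfold hiddenRank uniformRank at hr
      omega
    have h3 : (2 * b + (Y \ transversal r).card : ℝ) ≤ k + (Y ∩ transversal r).card := by
      exact_mod_cast h2
    have h4 := card_inter_sub_card_sdiff_transversal r Y
    have h5 : ∑ j, (if r j then (1 : ℝ) else -1) * (ε * d j) =
        ε * ∑ j, (if r j then (1 : ℝ) else -1) * d j := by
      rw [Finset.mul_sum]
      exact Finset.sum_congr rfl fun j _ => by ring
    rw [← Real.exp_add, h5, ← h4]
    refine Real.one_le_exp ?_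
    have : ε * (k * ε) ≤ ε * ((Y ∩ transversal r).card - (Y \ transversal r).card : ℝ) :=
      mul_le_mul_of_nonneg_left (by linarith) hε
    nlinarith
  have hprod : ∏ j, (2 * Real.cosh (ε * d j)) ≤ (2 * Real.exp (ε ^ 2 / 2)) ^ k := by
    calc ∏ j, (2 * Real.cosh (ε * d j)) ≤ ∏ _j : Fin k, (2 * Real.exp (ε ^ 2 / 2)) := by
          refine Finset.prod_le_prod (fun j _ => by positivity) fun j _ => ?_
          refine mul_le_mul_of_nonneg_left ((Real.cosh_le_exp_half_sq _).trans ?_) zero_le_two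
          rw [Real.exp_le_exp, mul_pow]
          nlinarith [mul_le_mul_of_nonneg_left (hd1 j) (sq_nonneg ε)]
      _ = _ := by simp
  calc ((Finset.univ.filter fun r : Fin k → Bool => hiddenRank b r Y ≠ uniformRank Y).card : ℝ)
      = ∑ r : Fin k → Bool, if hiddenRank b r Y ≠ uniformRank Y then (1 : ℝ) else 0 := by
        rw [Finset.sum_boole]
    _ ≤ ∑ r : Fin k → Bool, Real.exp (∑ j, (if r j then (1 : ℝ) else -1) * (ε * d j)) *
          Real.exp (-(k * ε ^ 2)) := by
        refine Finset.sum_le_sum fun r _ => ?_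
        split_ifs with h
        · exact key r h
        · positivity
    _ ≤ (2 * Real.exp (ε ^ 2 / 2)) ^ k * Real.exp (-(k * ε ^ 2)) := by
        rw [← Finset.sum_mul, sum_exp_signs]
        exact mul_le_mul_of_nonneg_right hprod (Real.exp_pos _).le
    _ = 2 ^ k * Real.exp (-(k * ε ^ 2 / 2)) := by
        rw [mul_pow, ← Real.exp_nat_mul, mul_assoc, ← Real.exp_add]
        ring_nf

/-! ### Few queries do not find a hidden transversal -/

theorem Run.prob_le_one (I : Input) (good : Finset (Fin I.n) → Prop) (run : Run I.n I.m) :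
    run.prob I good ≤ 1 := by
  induction run with
  | output A => unfold Run.prob; split_ifs <;> norm_num
  | askTerm i Y next ih => exact ih _
  | askObjective A next ih => exact ih _
  | coin next ih =>
    unfold Run.prob
    linarith [ih true, ih false]

/-- Suppose that every set distinguishes at most `D` of the functions `g r` from `g₀`, and that
a good output for `g r` distinguishes `g r` from `g₀`. Then the probability to find a good output,
summed over `r`, is at most `D` for each query on `g₀`, and another `D` for the output: as long as
no query distinguishes `g r` from `g₀`, the run on `g r` is the one on `g₀`. -/
theorem Run.sum_prob_le {ι : Type*} [Fintype ι] {k : ℕ} {c : Fin k → ℕ} {hc : ∀ j, 0 < c j}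
    {g₀ : Finset (Fin (k * 2)) → ℕ} {hg₀ : IsPositivePolymatroid fun Y => (g₀ Y : ℝ)}
    {g : ι → Finset (Fin (k * 2)) → ℕ} {hg : ∀ r, IsPositivePolymatroid fun Y => (g r Y : ℝ)}
    {D : ℝ} (hD : ∀ Y, ((Finset.univ.filter fun r => g r Y ≠ g₀ Y).card : ℝ) ≤ D)
    {good : ι → Finset (Fin (k * 2)) → Prop}
    (hgood : ∀ r A, good r A → g r (symmDiff A (firsts k)) ≠ g₀ (symmDiff A (firsts k)))
    (run : Run (k * 2) 3) (s : Finset ι) :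
    ∑ r ∈ s, Run.prob (pairInput k c hc (g r) (hg r)) (good r) run ≤
      (Run.queries (pairInput k c hc g₀ hg₀) run + 1) * D := by
  have hD0 : 0 ≤ D := (Nat.cast_nonneg _).trans (hD ∅)
  -- The effect of a single query, with the answers `a r` and `a₀`.
  have step : ∀ (next : ℕ → Run (k * 2) 3) (a : ι → ℕ) (a₀ q : ℕ) (Y : Finset (Fin (k * 2)))
      (_ : ∀ r, a r ≠ a₀ → g r Y ≠ g₀ Y)
      (_ : ∀ s : Finset ι, ∑ r ∈ s, Run.prob (pairInput k c hc (g r) (hg r)) (good r) (next a₀) ≤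
        (q + 1) * D) (s : Finset ι),
      ∑ r ∈ s, Run.prob (pairInput k c hc (g r) (hg r)) (good r) (next (a r)) ≤
        ((q + 1 : ℕ) + 1) * D := by
    intro next a a₀ q Y ha ih s
    rw [← Finset.sum_filter_add_sum_filter_not s fun r => a r = a₀]
    have h1 := ih (s.filter fun r => a r = a₀)
    rw [Finset.sum_congr rfl (g := fun r =>
      Run.prob (pairInput k c hc (g r) (hg r)) (good r) (next (a r)))
      (fun r hr => by rw [(Finset.mem_filter.1 hr).2])] at h1
    have h2 : ∑ r ∈ s.filter (fun r => ¬ a r = a₀),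
        Run.prob (pairInput k c hc (g r) (hg r)) (good r) (next (a r)) ≤ D := by
      calc _ ≤ ∑ r ∈ s.filter (fun r => ¬ a r = a₀), (1 : ℝ) :=
            Finset.sum_le_sum fun r _ => Run.prob_le_one _ _ _
        _ = (s.filter (fun r => ¬ a r = a₀)).card := by simp
        _ ≤ ((Finset.univ.filter fun r => g r Y ≠ g₀ Y).card : ℝ) := by
            refine Nat.cast_le.2 (Finset.card_le_card fun r hr => ?_)
            simpa using ha r (Finset.mem_filter.1 hr).2
        _ ≤ D := hD Y
    push_cast
    linarith
  induction run generalizing s with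
  | output A =>
    have h : ∀ r, Run.prob (pairInput k c hc (g r) (hg r)) (good r) (.output A) ≤
        if g r (symmDiff A (firsts k)) ≠ g₀ (symmDiff A (firsts k)) then (1 : ℝ) else 0 := by
      intro r
      have h : Run.prob (pairInput k c hc (g r) (hg r)) (good r) (.output A) =
        @ite _ (good r A) (Classical.propDecidable _) 1 0 := rfl
      rw [h]
      by_cases h' : good r A
      · rw [if_pos h', if_pos (hgood r A h')]
      · rw [if_neg h']
        split_ifs <;> norm_num
    calc _ ≤ ∑ r ∈ s, if g r (symmDiff A (firsts k)) ≠ g₀ (symmDiff A (firsts k))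
          then (1 : ℝ) else 0 := Finset.sum_le_sum fun r _ => h r
      _ ≤ ∑ r, if g r (symmDiff A (firsts k)) ≠ g₀ (symmDiff A (firsts k))
          then (1 : ℝ) else 0 :=
          Finset.sum_le_sum_of_subset_of_nonneg (Finset.subset_univ _)
            fun _ _ _ => by split_ifs <;> norm_num
      _ ≤ D := by rw [Finset.sum_boole]; exact hD _
      _ = _ := by simp [Run.queries]
  | askTerm i Y next ih =>
    refine step next (fun r => (pairInput k c hc (g r) (hg r)).f i Y)
      ((pairInput k c hc g₀ hg₀).f i Y) _ Y (fun r h => ?_) (ih _) s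
    fin_cases i
    · exact absurd rfl h
    · exact absurd rfl h
    · exact h
  | askObjective A next ih =>
    refine step next (fun r => (pairInput k c hc (g r) (hg r)).objective A)
      ((pairInput k c hc g₀ hg₀).objective A) _ (symmDiff A (firsts k)) (fun r h hr => h ?_)
      (ih _) s
    exact objective_pairInput_congr (k := k) hr
  | coin next ih =>
    have h1 := ih true s
    have h2 := ih false s
    simp only [Run.prob, Run.queries, ← Finset.sum_div, Finset.sum_add_distrib, Nat.cast_max]
    have h3 := mul_le_mul_of_nonneg_right (add_le_add_left (le_max_left
      (((next true).queries (pairInput k c hc g₀ hg₀) : ℕ) : ℝ)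
      ((next false).queries (pairInput k c hc g₀ hg₀) : ℕ)) 1) hD0
    have h4 := mul_le_mul_of_nonneg_right (add_le_add_left (le_max_right
      (((next true).queries (pairInput k c hc g₀ hg₀) : ℕ) : ℝ)
      ((next false).queries (pairInput k c hc g₀ hg₀) : ℕ)) 1) hD0
    linarith

/-- For the uniform matroid, the penalty for split pairs makes up for a smaller rank. -/
theorem two_mul_le_objective_uniformRank {k : ℕ} (hk : 0 < k) (A : Finset (Fin (k * 2))) :
    2 * k ≤ (pairInput k (fun _ => 1) (fun _ => one_pos) uniformRank
      (isPositivePolymatroid_uniformRank hk)).objective A := by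
  refine le_of_le_of_eq ?_ (objective_pairInput (k := k) A).symm
  have h : k ≤ (∑ j, if Respects A j then 0 else 1) + (symmDiff A (firsts k)).card := by
    rw [card_eq_sum_pairs, ← Finset.sum_add_distrib]
    calc k = ∑ _j : Fin k, 1 := by simp
      _ ≤ _ := by
        refine Finset.sum_le_sum fun j _ => ?_
        by_cases h1 : pairFst j ∈ A <;> by_cases h2 : pairSnd j ∈ A <;>
          simp [h1, h2, Respects, Finset.mem_symmDiff]
  simp only [Finset.sum_const, Finset.card_univ, Fintype.card_fin, smul_eq_mul, mul_one,
    uniformRank]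
  omega

theorem size_pairInput_uniformRank_le {k : ℕ} (hk : 0 < k) :
    (pairInput k (fun _ => 1) (fun _ => one_pos) uniformRank
      (isPositivePolymatroid_uniformRank hk)).size ≤ 5 * k + 3 := by
  have h1 : (pairInput k (fun _ => 1) (fun _ => one_pos) uniformRank
      (isPositivePolymatroid_uniformRank hk)).size = k * 2 + 3 + ∑ i : Fin 3,
      Nat.size ((![touchWeight fun _ => 1, touchWeight fun _ => 1, uniformRank] :
        Fin 3 → Finset (Fin (k * 2)) → ℕ) i Finset.univ) := rfl
  have h2 : ∀ a, Nat.size a ≤ a := fun a => Nat.size_le.2 Nat.lt_two_pow_self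
  have h3 : touchWeight (fun _ => 1) (Finset.univ : Finset (Fin (k * 2))) = k := by
    simp [touchWeight]
  have h4 : uniformRank (Finset.univ : Finset (Fin (k * 2))) = k := by
    simp only [uniformRank, Finset.card_univ, Fintype.card_fin]
    omega
  rw [h1, Fin.sum_univ_three]
  change k * 2 + 3 + (Nat.size (touchWeight (fun _ => 1) Finset.univ) +
    Nat.size (touchWeight (fun _ => 1) Finset.univ) + Nat.size (uniformRank Finset.univ)) ≤ _
  rw [h3, h4]
  have := h2 k
  lia

theorem eval_le_eval (q : Polynomial ℕ) {a b : ℕ} (h : a ≤ b) : q.eval a ≤ q.eval b := by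
  rw [Polynomial.eval_eq_sum, Polynomial.eval_eq_sum]
  exact Finset.sum_le_sum fun i _ => Nat.mul_le_mul_left _ (Nat.pow_le_pow_left h i)

open Filter Topology in
theorem tendsto_polynomial_mul_exp_neg (q : Polynomial ℕ) {δ : ℝ} (hδ : 0 < δ) :
    Tendsto (fun k : ℕ => ((q.eval (5 * k + 3) : ℕ) + 1) * Real.exp (-(k * δ))) atTop (𝓝 0) := by
  set Q : Polynomial ℝ := (q.map (Nat.castRingHom ℝ)).comp
    (Polynomial.C (5 / δ) * Polynomial.X + 3) + 1 with hQ
  have h1 := Q.tendsto_div_exp_atTop.comp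
    ((tendsto_natCast_atTop_atTop (R := ℝ)).atTop_mul_const hδ)
  refine h1.congr fun k => ?_
  have h2 : 5 / δ * (k * δ) + 3 = ((5 * k + 3 : ℕ) : ℝ) := by
    push_cast
    field_simp
  simp only [Function.comp_apply, hQ, Polynomial.eval_add, Polynomial.eval_comp,
    Polynomial.eval_mul, Polynomial.eval_C, Polynomial.eval_X, Polynomial.eval_ofNat,
    Polynomial.eval_one, h2, Real.exp_neg, ← div_eq_mul_inv]
  rw [Polynomial.eval_natCast_map]
  simp

/-- The approximation lower bound. For large `k`, an algorithm that approximates well has to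
find the hidden transversal in an input of optimum value about `3 / 2 * k`, where the output on the
uniform matroid has a value of at least `2 * k`. -/
theorem not_approximates {α : ℝ} (hα : α < 4 / 3) {p : ℝ} (hp : 0 < p) (alg : Algorithm)
    (hpoly : alg.PolynomiallyManyQueries) : ¬ alg.Approximates α p := by
  intro happ
  obtain ⟨q, hq⟩ := hpoly
  -- With `b` about `k * (1 + 2 * ε) / 2`, the hidden optimum is at most `k * (3 + 2 * ε) / 2`; the
  -- last condition makes `α` times this less than `2 * k`.
  obtain ⟨ε, hε, hε1, hαε⟩ : ∃ ε : ℝ, 0 < ε ∧ ε ≤ 1 / 2 ∧ α * (3 + 2 * ε) < 4 := by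
    refine ⟨min (1 / 2) ((4 - 3 * α) / 4), lt_min (by norm_num) (by linarith), min_le_left _ _, ?_⟩
    have h1 := min_le_left (1 / 2) ((4 - 3 * α) / 4)
    have h2 := min_le_right (1 / 2) ((4 - 3 * α) / 4)
    have h3 : 0 < min (1 / 2) ((4 - 3 * α) / 4) := lt_min (by norm_num) (by linarith)
    nlinarith
  have hlim := tendsto_polynomial_mul_exp_neg q (δ := ε ^ 2 / 2) (by positivity)
  obtain ⟨k, hk1, hk2⟩ := ((hlim.eventually (gt_mem_nhds hp)).and
    (tendsto_natCast_atTop_atTop.eventually_ge_atTop (2 / ε))).exists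
  -- The room of `k * ε ≥ 2` makes up for the rounding of `b`.
  have hkε : 2 ≤ k * ε := by rwa [div_le_iff₀ hε] at hk2
  have hk : 0 < k := by
    rcases Nat.eq_zero_or_pos k with rfl | h
    · norm_num at hkε
    · exact h
  have hkR : (0 : ℝ) < k := by exact_mod_cast hk
  set b := ⌊(k * (1 + 2 * ε) / 2 : ℝ)⌋₊ with hb
  have hb1 : (b : ℝ) ≤ k * (1 + 2 * ε) / 2 := Nat.floor_le (by positivity)
  have hb2 : k * (1 + 2 * ε) / 2 < (b : ℝ) + 1 := Nat.lt_floor_add_one _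
  have hb3 : b ≤ k := by
    have : (b : ℝ) ≤ k := by nlinarith
    exact_mod_cast this
  have hb4 : 0 < b := by
    have : (0 : ℝ) < b := by nlinarith
    exact_mod_cast this
  set I₀ := pairInput k (fun _ => 1) (fun _ => one_pos) uniformRank
    (isPositivePolymatroid_uniformRank hk) with hI₀
  set run : Run (k * 2) 3 := alg (k * 2) 3 I₀.B with hrun
  set I : (Fin k → Bool) → Input := fun r => pairInput k (fun _ => 1) (fun _ => one_pos)
    (hiddenRank b r) (isPositivePolymatroid_hiddenRank hb4 hk r) with hI
  set good : (Fin k → Bool) → Finset (Fin (k * 2)) → Prop := fun r A =>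
    ∀ A', ((I r).objective A : ℝ) ≤ α * (I r).objective A' with hgood
  have key := Run.sum_prob_le (c := fun _ => 1) (hc := fun _ => one_pos)
    (hg₀ := isPositivePolymatroid_uniformRank hk)
    (hg := fun r => isPositivePolymatroid_hiddenRank hb4 hk r)
    (card_hiddenRank_ne_le (k := k) (b := b) hε.le (by nlinarith)) (good := good) ?_
    run Finset.univ
  · have h1 : ∀ r, p ≤ Run.prob (I r) (good r) run := fun r => happ (I r)
    have h2 : Run.queries I₀ run ≤ q.eval (5 * k + 3) :=
      (hq I₀).trans (eval_le_eval q (size_pairInput_uniformRank_le hk))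
    have h3 := (Finset.sum_le_sum fun r (_ : r ∈ Finset.univ) => h1 r).trans key
    have h4 : (2 : ℝ) ^ k * p ≤ 2 ^ k *
        (((q.eval (5 * k + 3) : ℕ) + 1) * Real.exp (-(k * (ε ^ 2 / 2)))) := by
      calc (2 : ℝ) ^ k * p = ∑ _r : Fin k → Bool, p := by simp
        _ ≤ _ := h3
        _ ≤ ((q.eval (5 * k + 3) : ℕ) + 1) * (2 ^ k * Real.exp (-(k * ε ^ 2 / 2))) := by
            refine mul_le_mul_of_nonneg_right ?_ (by positivity)
            have : ((Run.queries I₀ run : ℕ) : ℝ) ≤ (q.eval (5 * k + 3) : ℕ) := by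
              exact_mod_cast h2
            linarith
        _ = _ := by ring_nf
    exact absurd (le_of_mul_le_mul_left h4 (by positivity)) (not_le.2 hk1)
  -- A good output distinguishes the hidden transversal: otherwise its value would be that on the
  -- uniform matroid.
  · intro r A hA heq
    have h1 : 2 * k ≤ (I r).objective A := by
      refine (two_mul_le_objective_uniformRank hk A).trans (le_of_eq ?_)
      exact objective_pairInput_congr (k := k) heq.symm
    have h2 : (I r).objective (symmDiff (transversal r) (firsts k)) = k + b := by
      refine (objective_transversal (k := k) r).trans ?_
      simp [hiddenRank_self hb3]
    have h3 := hA (symmDiff (transversal r) (firsts k))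
    rw [h2] at h3
    have h4 : (2 * k : ℝ) ≤ (I r).objective A := by exact_mod_cast h1
    push_cast at h3
    rcases le_or_gt α 0 with h | h
    · nlinarith
    · nlinarith

section Machines

open Turing TM2

section Programs

/-! ### Structured programs for multi-stack machines -/

variable {K : Type} [DecidableEq K] {Γ : K → Type} {σ : Type}

/-- From the configuration `c`, the machine `m` halts with state `v'` and stacks `S'` after at most
`t` steps. -/
inductive HaltsIn {Λ : Type} (m : Λ → Stmt Γ Λ σ) (v' : σ) (S' : ∀ k, List (Γ k)) :
    Cfg Γ Λ σ → ℕ → Prop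
  | halt (t : ℕ) : HaltsIn m v' S' ⟨none, v', S'⟩ t
  | step {l : Λ} {v : σ} {S : ∀ k, List (Γ k)} {t : ℕ} :
      HaltsIn m v' S' (stepAux (m l) v S) t → HaltsIn m v' S' ⟨some l, v, S⟩ (t + 1)

theorem HaltsIn.mono {Λ : Type} {m : Λ → Stmt Γ Λ σ} {v' : σ} {S' : ∀ k, List (Γ k)}
    {c : Cfg Γ Λ σ} {t : ℕ} (h : HaltsIn m v' S' c t) :
    ∀ {t' : ℕ}, t ≤ t' → HaltsIn m v' S' c t' := by
  induction h with
  | halt t => exact fun _ => .halt _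
  | @step l v S t _ ih =>
    intro t' ht
    obtain ⟨u, rfl⟩ : ∃ u, t' = u + 1 := ⟨t' - 1, by omega⟩
    exact .step (ih (by omega))

theorem flip_bind_iterate_none {α : Type*} (f : α → Option α) (n : ℕ) :
    (flip bind f)^[n] none = none := by
  induction n with
  | zero => rfl
  | succ n ih => rw [Function.iterate_succ_apply]; exact ih

theorem HaltsIn.exists_iterate {Λ : Type} {m : Λ → Stmt Γ Λ σ} {v' : σ} {S' : ∀ k, List (Γ k)}
    {c : Cfg Γ Λ σ} {t : ℕ} (h : HaltsIn m v' S' c t) :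
    ∃ n ≤ t, (flip bind (TM2.step m))^[n] (some c) = some ⟨none, v', S'⟩ := by
  induction h with
  | halt t => exact ⟨0, Nat.zero_le _, rfl⟩
  | step _ ih =>
    obtain ⟨n, hn, h⟩ := ih
    exact ⟨n + 1, by omega, h⟩

theorem HaltsIn.of_iterate {Λ : Type} {m : Λ → Stmt Γ Λ σ} {v' : σ} {S' : ∀ k, List (Γ k)} {n : ℕ} :
    ∀ {c : Cfg Γ Λ σ}, (flip bind (TM2.step m))^[n] (some c) = some ⟨none, v', S'⟩ →
      HaltsIn m v' S' c n := by
  induction n with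
  | zero =>
    intro c h
    obtain rfl := Option.some_injective _ h
    exact .halt _
  | succ n ih =>
    rintro ⟨_ | l, v, S⟩ h
    · rw [Function.iterate_succ_apply] at h
      change (flip bind (TM2.step m))^[n] none = _ at h
      rw [flip_bind_iterate_none] at h
      exact absurd h (by simp)
    · exact .step (ih h)

/-- A program: a machine that is entered at a fixed label and left by halting, so that programs can
be composed. -/
structure Prog (Γ : K → Type) (σ : Type) where
  /-- the labels -/
  Λ : Type
  /-- there are finitely many labels -/
  fin : Fintype Λ
  /-- the label at which the program is entered -/
  entry : Λ
  /-- the code -/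
  code : Λ → Stmt Γ Λ σ

/-- Started with state `v` and stacks `S`, the program halts with state `v'` and stacks `S'` after
at most `t` steps. -/
def Prog.Runs (P : Prog Γ σ) (v : σ) (S : ∀ k, List (Γ k)) (v' : σ) (S' : ∀ k, List (Γ k))
    (t : ℕ) : Prop :=
  HaltsIn P.code v' S' ⟨some P.entry, v, S⟩ t

theorem Prog.Runs.mono {P : Prog Γ σ} {v v' : σ} {S S' : ∀ k, List (Γ k)} {t t' : ℕ}
    (h : P.Runs v S v' S' t) (ht : t ≤ t') : P.Runs v S v' S' t' :=
  HaltsIn.mono h ht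

/-- Replace the labels of a statement by `f`, and halting by a jump to `e`, unless `e` is
`none`. -/
def redirect {Λ Λ' : Type} (f : Λ → Λ') (e : Option Λ') : Stmt Γ Λ σ → Stmt Γ Λ' σ
  | .push k g q => .push k g (redirect f e q)
  | .peek k g q => .peek k g (redirect f e q)
  | .pop k g q => .pop k g (redirect f e q)
  | .load g q => .load g (redirect f e q)
  | .branch g q₁ q₂ => .branch g (redirect f e q₁) (redirect f e q₂)
  | .goto g => .goto fun v => f (g v)
  | .halt => e.elim .halt fun l => .goto fun _ => l

/-- The configuration that corresponds to `c` when the code is changed by `redirect f e`. -/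
def redirectCfg {Λ Λ' : Type} (f : Λ → Λ') (e : Option Λ') (c : Cfg Γ Λ σ) : Cfg Γ Λ' σ :=
  ⟨c.l.elim e fun l => some (f l), c.var, c.stk⟩

theorem stepAux_redirect {Λ Λ' : Type} (f : Λ → Λ') (e : Option Λ') (q : Stmt Γ Λ σ) :
    ∀ (v : σ) (S : ∀ k, List (Γ k)),
      stepAux (redirect f e q) v S = redirectCfg f e (stepAux q v S) := by
  induction q with
  | push k g q ih => exact fun v S => ih _ _
  | peek k g q ih => exact fun v S => ih _ _
  | pop k g q ih => exact fun v S => ih _ _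
  | load g q ih => exact fun v S => ih _ _
  | branch g q₁ q₂ ih₁ ih₂ =>
    intro v S
    simp only [redirect, stepAux]
    cases g v
    · exact ih₂ _ _
    · exact ih₁ _ _
  | goto g => exact fun v S => rfl
  | halt =>
    intro v S
    cases e <;> rfl

/-- A machine whose code contains the code of `m`, with halting replaced by a jump to `e`,
simulates `m` and continues from `e`. -/
theorem HaltsIn.redirect {Λ Λ' : Type} {m : Λ → Stmt Γ Λ σ} {m' : Λ' → Stmt Γ Λ' σ} {f : Λ → Λ'}
    {e : Option Λ'} (hm : ∀ l, m' (f l) = redirect f e (m l)) {v' v'' : σ}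
    {S' S'' : ∀ k, List (Γ k)} {c : Cfg Γ Λ σ} {t t' : ℕ} (h : HaltsIn m v' S' c t)
    (h' : HaltsIn m' v'' S'' ⟨e, v', S'⟩ t') :
    HaltsIn m' v'' S'' (redirectCfg f e c) (t + t') := by
  induction h with
  | halt t => exact h'.mono (by omega)
  | @step l v S t _ ih =>
    rw [Nat.add_right_comm]
    refine .step ?_
    rw [hm, stepAux_redirect]
    exact ih

/-- The program that executes a single statement without jumps. -/
def Prog.atom (q : Stmt Γ Unit σ) : Prog Γ σ := ⟨Unit, inferInstance, (), fun _ => q⟩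

theorem Prog.atom_runs {q : Stmt Γ Unit σ} {v v' : σ} {S S' : ∀ k, List (Γ k)}
    (h : stepAux q v S = ⟨none, v', S'⟩) : (Prog.atom q).Runs v S v' S' 1 := by
  refine .step (t := 0) ?_
  change HaltsIn _ _ _ (stepAux q v S) 0
  rw [h]
  exact .halt 0

/-- Execute `P`, then `Q`. -/
def Prog.seq (P Q : Prog Γ σ) : Prog Γ σ where
  Λ := P.Λ ⊕ Q.Λ
  fin := @instFintypeSum _ _ P.fin Q.fin
  entry := .inl P.entry
  code
    | .inl l => redirect .inl (some (.inr Q.entry)) (P.code l)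
    | .inr l => redirect .inr none (Q.code l)

theorem Prog.seq_runs {P Q : Prog Γ σ} {v v' v'' : σ} {S S' S'' : ∀ k, List (Γ k)} {t t' : ℕ}
    (h : P.Runs v S v' S' t) (h' : Q.Runs v' S' v'' S'' t') :
    (P.seq Q).Runs v S v'' S'' (t + t') :=
  HaltsIn.redirect (m' := (P.seq Q).code) (f := .inl) (e := some (.inr Q.entry)) (fun _ => rfl) h
    (HaltsIn.redirect (m' := (P.seq Q).code) (f := .inr) (e := none) (fun _ => rfl) h' (.halt 0))

/-- Execute `P` if the state satisfies `c`, and `Q` otherwise. -/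
def Prog.ite (c : σ → Bool) (P Q : Prog Γ σ) : Prog Γ σ where
  Λ := Option (P.Λ ⊕ Q.Λ)
  fin := @instFintypeOption _ (@instFintypeSum _ _ P.fin Q.fin)
  entry := none
  code
    | none => .branch c (.goto fun _ => some (.inl P.entry)) (.goto fun _ => some (.inr Q.entry))
    | some (.inl l) => redirect (some ∘ .inl) none (P.code l)
    | some (.inr l) => redirect (some ∘ .inr) none (Q.code l)

theorem Prog.ite_runs_true {c : σ → Bool} {P Q : Prog Γ σ} {v v' : σ} {S S' : ∀ k, List (Γ k)}
    {t : ℕ} (hc : c v = true) (h : P.Runs v S v' S' t) :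
    (Prog.ite c P Q).Runs v S v' S' (t + 1) := by
  refine .step ?_
  change HaltsIn _ _ _ (cond (c v) _ _) _
  rw [hc]
  exact HaltsIn.redirect (m' := (Prog.ite c P Q).code) (f := some ∘ .inl) (e := none)
    (fun _ => rfl) h (.halt 0)

theorem Prog.ite_runs_false {c : σ → Bool} {P Q : Prog Γ σ} {v v' : σ} {S S' : ∀ k, List (Γ k)}
    {t : ℕ} (hc : c v = false) (h : Q.Runs v S v' S' t) :
    (Prog.ite c P Q).Runs v S v' S' (t + 1) := by
  refine .step ?_
  change HaltsIn _ _ _ (cond (c v) _ _) _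
  rw [hc]
  exact HaltsIn.redirect (m' := (Prog.ite c P Q).code) (f := some ∘ .inr) (e := none)
    (fun _ => rfl) h (.halt 0)

/-- Pop the stack `k` and update the state by `u`, repeatedly; execute `P` after each time, and
halt when the stack was empty. The state has to tell whether it was: this is the role of `c`. -/
def Prog.loop (k : K) (u : σ → Option (Γ k) → σ) (c : σ → Bool) (P : Prog Γ σ) : Prog Γ σ where
  Λ := Option P.Λ
  fin := @instFintypeOption _ P.fin
  entry := none
  code
    | none => .pop k u (.branch c (.goto fun _ => some P.entry) .halt)
    | some l => redirect some (some none) (P.code l)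

theorem Prog.loop_runs_nil {k : K} {u : σ → Option (Γ k) → σ} {c : σ → Bool} {P : Prog Γ σ}
    {v : σ} {S : ∀ k, List (Γ k)} (hS : S k = []) (hc : c (u v none) = false) :
    (Prog.loop k u c P).Runs v S (u v none) S 1 := by
  refine .step (t := 0) ?_
  change HaltsIn _ _ _ (cond (c (u v (S k).head?))
    _ ⟨none, u v (S k).head?, Function.update S k (S k).tail⟩) _
  rw [hS, List.head?_nil, hc, List.tail_nil, ← hS, Function.update_eq_self]
  exact .halt 0

theorem Prog.loop_runs_cons {k : K} {u : σ → Option (Γ k) → σ} {c : σ → Bool} {P : Prog Γ σ}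
    {v v' v'' : σ} {S S' S'' : ∀ k, List (Γ k)} {a : Γ k} {l : List (Γ k)} {t t' : ℕ}
    (hS : S k = a :: l) (hc : c (u v (some a)) = true)
    (h : P.Runs (u v (some a)) (Function.update S k l) v' S' t)
    (h' : (Prog.loop k u c P).Runs v' S' v'' S'' t') :
    (Prog.loop k u c P).Runs v S v'' S'' (t + t' + 1) := by
  refine .step ?_
  change HaltsIn _ _ _ (cond (c (u v (S k).head?))
    ⟨some (some P.entry), u v (S k).head?, Function.update S k (S k).tail⟩ _) _
  rw [hS, List.head?_cons, hc, List.tail_cons]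
  exact HaltsIn.redirect (m' := (Prog.loop k u c P).code) (f := some) (e := some none)
    (fun _ => rfl) h h'

theorem Prog.loop_runs_congr {k : K} {u : σ → Option (Γ k) → σ} {c : σ → Bool} {P : Prog Γ σ}
    {v w v' : σ} {S S' : ∀ k, List (Γ k)} {t : ℕ} (huv : ∀ a, u v a = u w a)
    (h : (Prog.loop k u c P).Runs v S v' S' t) : (Prog.loop k u c P).Runs w S v' S' t := by
  cases h with
  | @step _ _ _ t h =>
    refine .step ?_
    change HaltsIn _ _ _ (cond (c (u v (S k).head?))
      ⟨some (some P.entry), u v (S k).head?, Function.update S k (S k).tail⟩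
      ⟨none, u v (S k).head?, Function.update S k (S k).tail⟩) t at h
    rw [huv] at h
    exact h

/-- A loop over a stack with content `l`, where `T i l'` are the stacks after `i` rounds with `l'`
remaining, and the state between the rounds is constant. -/
theorem Prog.loop_runs {k : K} {u : σ → Option (Γ k) → σ} {c : σ → Bool} {P : Prog Γ σ} {v : σ}
    (T : ℕ → List (Γ k) → ∀ k, List (Γ k)) {b : ℕ} (hT : ∀ i l, T i l k = l)
    (hnone : c (u v none) = false) (hu : u v none = v) (hsome : ∀ a, c (u v (some a)) = true)
    (h : ∀ i a l, P.Runs (u v (some a)) (Function.update (T i (a :: l)) k l) v (T (i + 1) l) b)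
    (l : List (Γ k)) : ∀ i : ℕ,
    (Prog.loop k u c P).Runs v (T i l) v (T (i + l.length) []) (l.length * (b + 1) + 1) := by
  induction l with
  | nil =>
    intro i
    have := Prog.loop_runs_nil (P := P) (hT i []) hnone
    rw [hu] at this
    exact this.mono (by omega)
  | cons a l ih =>
    intro i
    have := Prog.loop_runs_cons (hT i (a :: l)) (hsome a) (h i a l) (ih (i + 1))
    rw [Nat.add_assoc i 1, Nat.add_comm 1] at this
    refine this.mono (le_of_eq ?_)
    rw [List.length_cons]
    ring

/-- A loop over a stack with content `l`, where `V d` and `T d l'` are the state and the stacks when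
the symbols of `d` (the last one first) have been processed and those of `l'` remain. -/
theorem Prog.loop_runs_list {k : K} {u : σ → Option (Γ k) → σ} {c : σ → Bool} {P : Prog Γ σ}
    (V : List (Γ k) → σ) (T : List (Γ k) → List (Γ k) → ∀ k, List (Γ k)) {b : ℕ}
    (hT : ∀ d l, T d l k = l) (hnone : ∀ v, c (u v none) = false)
    (hsome : ∀ v a, c (u v (some a)) = true)
    (h : ∀ d a l, P.Runs (u (V d) (some a)) (Function.update (T d (a :: l)) k l) (V (a :: d))
      (T (a :: d) l) b)
    (l : List (Γ k)) : ∀ d : List (Γ k),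
    (Prog.loop k u c P).Runs (V d) (T d l) (u (V (l.reverse ++ d)) none) (T (l.reverse ++ d) [])
      (l.length * (b + 1) + 1) := by
  induction l with
  | nil => exact fun d => (Prog.loop_runs_nil (hT d []) (hnone _)).mono (by omega)
  | cons a l ih =>
    intro d
    have := Prog.loop_runs_cons (hT d (a :: l)) (hsome _ a) (h d a l) (ih (a :: d))
    rw [List.reverse_cons, List.append_assoc]
    refine this.mono (le_of_eq ?_)
    rw [List.length_cons]
    ring

/-! ### Machines as subroutines -/

section Embedding

variable {K' : Type} [DecidableEq K'] {Γ' : K' → Type} {ρ : Type}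

/-- The alphabets of the stacks of a machine and of additional stacks. -/
abbrev joinAlph (Γ : K → Type) (Γ' : K' → Type) : K ⊕ K' → Type
  | .inl k => Γ k
  | .inr k => Γ' k

/-- The stacks of a machine together with additional stacks. -/
def joinStk (S : ∀ k, List (Γ k)) (T : ∀ k, List (Γ' k)) : ∀ k : K ⊕ K', List (joinAlph Γ Γ' k)
  | .inl k => S k
  | .inr k => T k

theorem update_joinStk_inl (S : ∀ k, List (Γ k)) (T : ∀ k, List (Γ' k)) (k : K) (l : List (Γ k)) :
    Function.update (joinStk S T) (.inl k) l = joinStk (Function.update S k l) T := by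
  funext i
  rcases i with i | i
  · by_cases h : i = k
    · subst h
      simp [joinStk]
    · rw [Function.update_of_ne (by simpa using h)]
      simp [joinStk, h]
  · rw [Function.update_of_ne (by simp)]
    rfl

theorem update_joinStk_inr (S : ∀ k, List (Γ k)) (T : ∀ k, List (Γ' k)) (k : K')
    (l : List (Γ' k)) :
    Function.update (joinStk S T) (.inr k) l = joinStk S (Function.update T k l) := by
  funext i
  rcases i with i | i
  · rw [Function.update_of_ne (by simp)]
    rfl
  · by_cases h : i = k
    · subst h
      simp [joinStk]
    · rw [Function.update_of_ne (by simpa using h)]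
      simp [joinStk, h]

/-- A statement of a machine as a statement of a machine with additional stacks and an additional
component of the state. -/
def embed {Λ : Type} : Stmt Γ Λ σ → Stmt (joinAlph Γ Γ') Λ (σ × ρ)
  | .push k g q => .push (.inl k) (fun v => g v.1) (embed q)
  | .peek k g q => .peek (.inl k) (fun v a => (g v.1 a, v.2)) (embed q)
  | .pop k g q => .pop (.inl k) (fun v a => (g v.1 a, v.2)) (embed q)
  | .load g q => .load (fun v => (g v.1, v.2)) (embed q)
  | .branch g q₁ q₂ => .branch (fun v => g v.1) (embed q₁) (embed q₂)
  | .goto g => .goto fun v => g v.1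
  | .halt => .halt

theorem stepAux_embed {Λ : Type} (q : Stmt Γ Λ σ) (r : ρ) (T : ∀ k, List (Γ' k)) :
    ∀ (v : σ) (S : ∀ k, List (Γ k)), stepAux (embed q) (v, r) (joinStk S T) =
      ⟨(stepAux q v S).l, ((stepAux q v S).var, r), joinStk (stepAux q v S).stk T⟩ := by
  induction q with
  | push k g q ih =>
    intro v S
    simp only [embed, stepAux]
    rw [update_joinStk_inl]
    exact ih _ _
  | peek k g q ih => exact fun v S => ih _ _
  | pop k g q ih =>
    intro v S
    simp only [embed, stepAux]
    rw [update_joinStk_inl]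
    exact ih _ _
  | load g q ih => exact fun v S => ih _ _
  | branch g q₁ q₂ ih₁ ih₂ =>
    intro v S
    simp only [embed, stepAux]
    cases g v
    · exact ih₂ _ _
    · exact ih₁ _ _
  | goto g => exact fun v S => rfl
  | halt => exact fun v S => rfl

theorem HaltsIn.embed {Λ : Type} {m : Λ → Stmt Γ Λ σ} {v' : σ} {S' : ∀ k, List (Γ k)}
    {c : Cfg Γ Λ σ} {t : ℕ} (h : HaltsIn m v' S' c t) (r : ρ) (T : ∀ k, List (Γ' k)) :
    HaltsIn (fun l => SHMin.embed (m l)) (v', r) (joinStk S' T) ⟨c.l, (c.var, r), joinStk c.stk T⟩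
      t := by
  induction h with
  | halt t => exact .halt t
  | step _ ih =>
    refine .step ?_
    rw [stepAux_embed]
    exact ih

end Embedding

/-- The stacks that are empty except for the content `l` of the stack `k`. -/
def singleStk (k : K) (l : List (Γ k)) : ∀ k, List (Γ k) := Function.update (fun _ => []) k l

@[simp] theorem singleStk_same (k : K) (l : List (Γ k)) : singleStk k l k = l := by
  simp [singleStk]

@[simp] theorem update_singleStk (k : K) (l l' : List (Γ k)) :
    Function.update (singleStk k l) k l' = singleStk k l' := by
  simp [singleStk]

theorem singleStk_nil (k : K) : singleStk k ([] : List (Γ k)) = fun _ => [] := by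
  simp [singleStk]

theorem initList_eq (tm : FinTM2) (s : List (tm.Γ tm.k₀)) :
    initList tm s = ⟨some tm.main, tm.initialState, singleStk tm.k₀ s⟩ := by
  unfold initList singleStk
  congr 1
  funext k
  by_cases h : k = tm.k₀
  · subst h
    simp
  · simp [h]

theorem haltList_eq (tm : FinTM2) (s : List (tm.Γ tm.k₁)) :
    haltList tm s = ⟨none, tm.initialState, singleStk tm.k₁ s⟩ := by
  unfold haltList singleStk
  congr 1
  funext k
  by_cases h : k = tm.k₁
  · subst h
    simp
  · simp [h]

/-- A machine as a program with additional stacks and an additional component of the state. -/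
def Prog.ofMachine (tm : FinTM2) {K' : Type} (Γ' : K' → Type) (ρ : Type) :
    Prog (joinAlph tm.Γ Γ') (tm.σ × ρ) :=
  ⟨tm.Λ, tm.ΛFin, tm.main, fun l => embed (tm.m l)⟩

theorem Prog.ofMachine_runs {tm : FinTM2} {s : List (tm.Γ tm.k₀)} {s' : List (tm.Γ tm.k₁)} {t : ℕ}
    (h : TM2OutputsInTime tm s (some s') t) {K' : Type} [DecidableEq K'] {Γ' : K' → Type} {ρ : Type}
    (r : ρ) (T : ∀ k, List (Γ' k)) :
    (Prog.ofMachine tm Γ' ρ).Runs (tm.initialState, r) (joinStk (singleStk tm.k₀ s) T)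
      (tm.initialState, r) (joinStk (singleStk tm.k₁ s') T) t := by
  obtain ⟨n, hn, h1⟩ : ∃ n ≤ t,
      (flip bind tm.step)^[n] (some (initList tm s)) = some (haltList tm s') :=
    ⟨h.steps, h.steps_le_m, h.evals_in_steps⟩
  rw [initList_eq, haltList_eq] at h1
  exact ((HaltsIn.of_iterate h1).mono hn).embed r T

/-- A program that computes `f` in polynomial time, as a machine. -/
theorem Prog.nonempty_computable [Fintype K] [Fintype σ] {α β αΓ βΓ : Type} {ea : α → List αΓ}
    {eb : β → List βΓ} {f : α → β} (P : Prog Γ σ) (v₀ : σ) {k₀ k₁ : K} [Fintype (Γ k₀)]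
    (e₀ : Γ k₀ ≃ αΓ) (e₁ : Γ k₁ ≃ βΓ) (time : Polynomial ℕ)
    (h : ∀ a, P.Runs v₀ (singleStk k₀ ((ea a).map e₀.symm)) v₀
      (singleStk k₁ ((eb (f a)).map e₁.symm)) (time.eval (ea a).length)) :
    Nonempty (TM2ComputableInPolyTime ea eb f) := by
  let _ := P.fin
  refine ⟨{
    tm := { k₀ := k₀, k₁ := k₁, Γ := Γ, Λ := P.Λ, main := P.entry, σ := σ, initialState := v₀,
            m := P.code }
    inputAlphabet := e₀
    outputAlphabet := e₁
    time := time
    outputsFun := fun a => Classical.choice ?_ }⟩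
  obtain ⟨n, hn, h'⟩ := HaltsIn.exists_iterate (h a)
  refine ⟨⟨⟨n, ?_⟩, hn⟩⟩
  rw [Option.map_some, initList_eq, haltList_eq]
  exact h'

end Programs

/-! ### The machine that computes the explicit part of the input -/

/-- The stacks of the machine that computes the explicit part of the input: two that hold the length
of `x`, two that hold numbers, and the output. All numbers are in unary. -/
inductive ExpK
  | x | x' | a | a' | out
  deriving DecidableEq

instance : Fintype ExpK := ⟨{.x, .x', .a, .a', .out}, fun k => by cases k <;> simp⟩

/-- The symbols in which the explicit part of the input is encoded. -/
abbrev ExpSym : Type := Bool ⊕ (Bool ⊕ (Bool ⊕ Bool))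

/-- The symbol for a unary digit of the number of elements. -/
abbrev symN : ExpSym := .inl true

/-- The symbol for a unary digit of the number of functions. -/
abbrev symM : ExpSym := .inr (.inl true)

/-- The symbols for the bits of the sets. -/
abbrev symB (b : Bool) : ExpSym := .inr (.inr (.inl b))

/-- The symbols for the bits of the threshold. -/
abbrev symT (b : Bool) : ExpSym := .inr (.inr (.inr b))

/-- The alphabets of the stacks. -/
abbrev ExpAlph : ExpK → Type
  | .x => Bool
  | .x' => Bool
  | .a => Bool
  | .a' => Bool
  | .out => ExpSym

/-- The stacks with the given contents. -/
def expStk (x x' a a' : List Bool) (o : List ExpSym) : ∀ k, List (ExpAlph k)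
  | .x => x
  | .x' => x'
  | .a => a
  | .a' => a'
  | .out => o

section
variable (x x' a a' l : List Bool) (o l' : List ExpSym)

@[simp] theorem update_expStk_x :
    Function.update (expStk x x' a a' o) .x l = expStk l x' a a' o := by
  funext i; cases i <;> rfl

@[simp] theorem update_expStk_x' :
    Function.update (expStk x x' a a' o) .x' l = expStk x l a a' o := by
  funext i; cases i <;> rfl

@[simp] theorem update_expStk_a :
    Function.update (expStk x x' a a' o) .a l = expStk x x' l a' o := by
  funext i; cases i <;> rfl

@[simp] theorem update_expStk_a' :
    Function.update (expStk x x' a a' o) .a' l = expStk x x' a l o := by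
  funext i; cases i <;> rfl

@[simp] theorem update_expStk_out :
    Function.update (expStk x x' a a' o) .out l' = expStk x x' a a' l' := by
  funext i; cases i <;> rfl

end

/-- The unary representation of a number. -/
abbrev un (n : ℕ) : List Bool := List.replicate n true

/-- Execute `P` for each symbol on the stack `x`, which is emptied. -/
abbrev forX (P : Prog ExpAlph (Option Bool)) : Prog ExpAlph (Option Bool) :=
  .loop .x (fun _ a => a) Option.isSome P

/-- Execute `P` for each symbol on the stack `x'`, which is emptied. -/
abbrev forX' (P : Prog ExpAlph (Option Bool)) : Prog ExpAlph (Option Bool) :=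
  .loop .x' (fun _ a => a) Option.isSome P

/-- Execute `P` for each symbol on the stack `a`, which is emptied. -/
abbrev forA (P : Prog ExpAlph (Option Bool)) : Prog ExpAlph (Option Bool) :=
  .loop .a (fun _ a => a) Option.isSome P

/-- Execute `P` for each symbol on the stack `a'`, which is emptied. -/
abbrev forA' (P : Prog ExpAlph (Option Bool)) : Prog ExpAlph (Option Bool) :=
  .loop .a' (fun _ a => a) Option.isSome P

/-- Clear the state and leave the program. -/
abbrev expDone : Stmt ExpAlph Unit (Option Bool) := .load (fun _ => none) .halt

/-- Push the word `os` onto the output. -/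
def emit : List ExpSym → Stmt ExpAlph Unit (Option Bool) → Stmt ExpAlph Unit (Option Bool)
  | [], q => q
  | s :: os, q => emit os (.push .out (fun _ => s) q)

theorem stepAux_emit (os : List ExpSym) : ∀ (q : Stmt ExpAlph Unit (Option Bool))
    (v : Option Bool) (x x' a a' : List Bool) (o : List ExpSym),
    stepAux (emit os q) v (expStk x x' a a' o) = stepAux q v (expStk x x' a a' (os ++ o)) := by
  induction os with
  | nil => exact fun _ _ _ _ _ _ _ => rfl
  | cons s os ih =>
    intro q v x x' a a' o
    rw [emit, ih]
    simp [expStk]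

theorem eraseX_runs (x x' a a' : List Bool) (o : List ExpSym) :
    (forX (.atom (.push .x' (fun _ => true) expDone))).Runs none (expStk x x' a a' o)
      none (expStk [] (un x.length ++ x') a a' o) (x.length * 2 + 1) := by
  have := Prog.loop_runs (k := ExpK.x) (u := fun _ a => a) (c := Option.isSome)
    (P := .atom (.push .x' (fun _ => true) expDone)) (v := none) (b := 1)
    (fun i l => expStk l (un i ++ x') a a' o) (fun _ _ => rfl) rfl rfl (fun _ => rfl)
    (fun i b l => Prog.atom_runs (by simp [expStk, List.replicate_succ])) x 0
  simpa using this

theorem restoreX_runs (x x' a a' : List Bool) (o : List ExpSym) :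
    (forX' (.atom (.push .x (fun _ => true) expDone))).Runs none (expStk x x' a a' o)
      none (expStk (un x'.length ++ x) [] a a' o) (x'.length * 2 + 1) := by
  have := Prog.loop_runs (k := ExpK.x') (u := fun _ a => a) (c := Option.isSome)
    (P := .atom (.push .x (fun _ => true) expDone)) (v := none) (b := 1)
    (fun i l => expStk (un i ++ x) l a a' o) (fun _ _ => rfl) rfl rfl (fun _ => rfl)
    (fun i b l => Prog.atom_runs (by simp [expStk, List.replicate_succ])) x' 0
  simpa using this

theorem addX_runs (x x' a a' : List Bool) (o : List ExpSym) :
    (forX (.atom (.push .x' (fun _ => true) (.push .a' (fun _ => true) expDone)))).Runs none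
      (expStk x x' a a' o) none (expStk [] (un x.length ++ x') a (un x.length ++ a') o)
      (x.length * 2 + 1) := by
  have := Prog.loop_runs (k := ExpK.x) (u := fun _ a => a) (c := Option.isSome)
    (P := .atom (.push .x' (fun _ => true) (.push .a' (fun _ => true) expDone)))
    (v := none) (b := 1)
    (fun i l => expStk l (un i ++ x') a (un i ++ a') o) (fun _ _ => rfl) rfl rfl (fun _ => rfl)
    (fun i b l => Prog.atom_runs (by simp [expStk, List.replicate_succ])) x 0
  simpa using this

theorem mulX_runs (N : ℕ) (a : List Bool) (o : List ExpSym) :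
    (forA (.seq (forX (.atom (.push .x' (fun _ => true) (.push .a' (fun _ => true) expDone))))
      (forX' (.atom (.push .x (fun _ => true) expDone))))).Runs none
      (expStk (un N) [] a [] o) none (expStk (un N) [] [] (un (a.length * N)) o)
      (a.length * (4 * N + 3) + 1) := by
  have := Prog.loop_runs (k := ExpK.a) (u := fun _ a => a) (c := Option.isSome)
    (P := .seq (forX (.atom (.push .x' (fun _ => true) (.push .a' (fun _ => true) expDone))))
      (forX' (.atom (.push .x (fun _ => true) expDone)))) (v := none) (b := 4 * N + 2)
    (fun i l => expStk (un N) [] l (un (i * N)) o)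
    (fun _ _ => rfl) rfl rfl (fun _ => rfl) (fun i b l => ?_) a 0
  · simpa using this
  · have h1 := addX_runs (un N) [] l (un (i * N)) o
    have h2 := restoreX_runs [] (un N) l (un (N + i * N)) o
    simp only [List.length_replicate, List.append_nil, List.replicate_append_replicate] at h1 h2
    rw [update_expStk_a, Nat.add_mul, Nat.one_mul, Nat.add_comm (i * N)]
    have h3 := Prog.seq_runs (Prog.loop_runs_congr (v := none) (w := some b) (fun _ => rfl) h1) h2
    exact h3.mono (by omega)

/-- Push `true` onto the other number stack, and the word `os` onto the output, for each symbol on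
the stack `a`. -/
abbrev emitA (os : List ExpSym) : Prog ExpAlph (Option Bool) :=
  forA (.atom (emit os (.push .a' (fun _ => true) expDone)))

/-- Push `true` onto the other number stack, and the word `os` onto the output, for each symbol on
the stack `a'`. -/
abbrev emitA' (os : List ExpSym) : Prog ExpAlph (Option Bool) :=
  forA' (.atom (emit os (.push .a (fun _ => true) expDone)))

theorem emitA_runs (os : List ExpSym) (x x' a a' : List Bool) (o : List ExpSym) :
    (emitA os).Runs none (expStk x x' a a' o) none
      (expStk x x' [] (un a.length ++ a') ((List.replicate a.length os).flatten ++ o))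
      (a.length * 2 + 1) := by
  have := Prog.loop_runs (k := ExpK.a) (u := fun _ a => a) (c := Option.isSome)
    (P := .atom (emit os (.push .a' (fun _ => true) expDone))) (v := none) (b := 1)
    (fun i l => expStk x x' l (un i ++ a') ((List.replicate i os).flatten ++ o))
    (fun _ _ => rfl) rfl rfl (fun _ => rfl)
    (fun i b l => Prog.atom_runs (by
      rw [update_expStk_a, stepAux_emit]
      simp [expStk, List.replicate_succ])) a 0
  simpa using this

theorem emitA'_runs (os : List ExpSym) (x x' a a' : List Bool) (o : List ExpSym) :
    (emitA' os).Runs none (expStk x x' a a' o) none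
      (expStk x x' (un a'.length ++ a) [] ((List.replicate a'.length os).flatten ++ o))
      (a'.length * 2 + 1) := by
  have := Prog.loop_runs (k := ExpK.a') (u := fun _ a => a) (c := Option.isSome)
    (P := .atom (emit os (.push .a (fun _ => true) expDone))) (v := none) (b := 1)
    (fun i l => expStk x x' (un i ++ a) l ((List.replicate i os).flatten ++ o))
    (fun _ _ => rfl) rfl rfl (fun _ => rfl)
    (fun i b l => Prog.atom_runs (by
      rw [update_expStk_a', stepAux_emit]
      simp [expStk, List.replicate_succ])) a' 0
  simpa using this

theorem clearX_runs (x x' a a' : List Bool) (o : List ExpSym) :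
    (forX (.atom expDone)).Runs none (expStk x x' a a' o) none (expStk [] x' a a' o)
      (x.length * 2 + 1) :=
  Prog.loop_runs (k := ExpK.x) (u := fun _ a => a) (c := Option.isSome)
    (P := .atom expDone) (v := none) (b := 1) (fun _ l => expStk l x' a a' o)
    (fun _ _ => rfl) rfl rfl (fun _ => rfl)
    (fun _ _ _ => Prog.atom_runs (by simp)) x 0

theorem clearA_runs (x x' a a' : List Bool) (o : List ExpSym) :
    (forA (.atom expDone)).Runs none (expStk x x' a a' o) none (expStk x x' [] a' o)
      (a.length * 2 + 1) :=
  Prog.loop_runs (k := ExpK.a) (u := fun _ a => a) (c := Option.isSome)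
    (P := .atom expDone) (v := none) (b := 1) (fun _ l => expStk x x' l a' o)
    (fun _ _ => rfl) rfl rfl (fun _ => rfl)
    (fun _ _ _ => Prog.atom_runs (by simp)) a 0

theorem emit_runs (os : List ExpSym) (x x' a a' : List Bool) (o : List ExpSym) :
    (Prog.atom (emit os .halt)).Runs none (expStk x x' a a' o) none (expStk x x' a a' (os ++ o))
      1 :=
  Prog.atom_runs (by rw [stepAux_emit]; rfl)

/-- Every polynomial with natural coefficients can be evaluated in polynomial time, by Horner's
scheme. -/
theorem exists_prog_eval (p : Polynomial ℕ) :
    ∃ (P : Prog ExpAlph (Option Bool)) (T : Polynomial ℕ), ∀ N o,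
      P.Runs none (expStk (un N) [] [] [] o) none (expStk (un N) [] (un (p.eval N)) [] o)
        (T.eval N) := by
  induction p using Polynomial.recOnHorner with
  | M0 => exact ⟨.atom .halt, 1, fun N o => by simpa using Prog.atom_runs rfl⟩
  | MC p c _ _ ih =>
    clear * - ih
    induction c with
    | zero => simpa using ih
    | succ c ih' =>
      obtain ⟨P, T, h⟩ := ih'
      refine ⟨P.seq (.atom (.push .a (fun _ => true) .halt)), T + 1, fun N o => ?_⟩
      have := Prog.seq_runs (h N o) (Prog.atom_runs (q := .push .a (fun _ => true) .halt)
        (v' := none) (S' := expStk (un N) [] (un ((p + Polynomial.C (c + 1)).eval N)) [] o) ?_)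
      · simpa using this
      · simp only [stepAux, update_expStk_a, Polynomial.eval_add, Polynomial.eval_C,
          ← Nat.add_assoc, un]
        simp [expStk, List.replicate_succ]
  | MX p _ ih =>
    obtain ⟨P, T, h⟩ := ih
    refine ⟨(P.seq (forA (.seq (forX (.atom (.push .x' (fun _ => true)
      (.push .a' (fun _ => true) expDone)))) (forX' (.atom (.push .x (fun _ => true) expDone)))))).seq
      (emitA' []), T + (p * (4 * Polynomial.X + 3) + 1) + (p * Polynomial.X * 2 + 1), fun N o => ?_⟩
    have h1 := mulX_runs N (un (p.eval N)) o
    have h2 := emitA'_runs [] (un N) [] [] (un (p.eval N * N)) o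
    simp only [List.length_replicate, List.append_nil, List.flatten_replicate_nil,
      List.nil_append] at h1 h2
    have := Prog.seq_runs (Prog.seq_runs (h N o) h1) h2
    simp only [Polynomial.eval_mul, Polynomial.eval_X]
    refine this.mono (le_of_eq ?_)
    simp

/-- The explicit part of the input with `k` pairs and threshold
`2 ^ (k + 1) * (2 ^ (2 * k) - 1)`. -/
def explicitWord (k : ℕ) : List ExpSym :=
  (List.replicate k [symN, symN]).flatten ++
  ([symM, symM, symM] ++
  ((List.replicate k [symB false, symB false]).flatten ++
  ((List.replicate k [symB true, symB true]).flatten ++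
  ((List.replicate k [symB true, symB false]).flatten ++
  ([symT false] ++
  ((List.replicate k [symT false]).flatten ++
  (List.replicate k [symT true, symT true]).flatten))))))

/-- The explicit part of the input with `p.eval x.length` pairs can be computed from `x` in
polynomial time. -/
theorem exists_prog_explicitWord (p : Polynomial ℕ) :
    ∃ (P : Prog ExpAlph (Option Bool)) (T : Polynomial ℕ), ∀ x : List Bool,
      P.Runs none (singleStk .x x) none (singleStk .out (explicitWord (p.eval x.length)))
        (T.eval x.length) := by
  obtain ⟨P, T, h⟩ := exists_prog_eval p
  -- The word is emitted from its end, since the output is a stack. In each loop the number `k`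
  -- moves from one of the two number stacks to the other.
  refine ⟨((((((((((forX (.atom (.push .x' (fun _ => true) expDone))).seq
    (forX' (.atom (.push .x (fun _ => true) expDone)))).seq P).seq
    (emitA [symT true, symT true])).seq
    (emitA' [symT false])).seq
    (.atom (emit [symT false] .halt))).seq
    (emitA [symB true, symB false])).seq
    (emitA' [symB true, symB true])).seq
    (emitA [symB false, symB false])).seq
    (.atom (emit [symM, symM, symM] .halt))).seq
    ((emitA' [symN, symN]).seq ((forX (.atom expDone)).seq (forA (.atom expDone)))),
    T + 3 * (Polynomial.X * 2 + 1) + 7 * (p * 2 + 1) + 2, fun x => ?_⟩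
  set k := p.eval x.length with hk
  have h1 := eraseX_runs x [] [] [] []
  have h2 := restoreX_runs [] (un x.length) [] [] []
  have h3 := h x.length []
  have h4 := emitA_runs [symT true, symT true] (un x.length) []
    (un k) [] []
  have h5 := emitA'_runs [symT false] (un x.length) [] [] (un k)
  have h6 := emit_runs [symT false] (un x.length) [] (un k) []
  have h7 := emitA_runs [symB true, symB false]
    (un x.length) [] (un k) []
  have h8 := emitA'_runs [symB true, symB true]
    (un x.length) [] [] (un k)
  have h9 := emitA_runs [symB false, symB false]
    (un x.length) [] (un k) []
  have h10 := emit_runs [symM, symM, symM]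
    (un x.length) [] [] (un k)
  have h11 := emitA'_runs [symN, symN] (un x.length) [] [] (un k)
  have h12 := clearX_runs (un x.length) [] (un k) []
  have h13 := clearA_runs [] [] (un k) []
  simp only [List.length_replicate, List.append_nil, ← hk]
    at h1 h2 h3 h4 h5 h6 h7 h8 h9 h10 h11 h12 h13
  have key := Prog.seq_runs (Prog.seq_runs (Prog.seq_runs (Prog.seq_runs (Prog.seq_runs
    (Prog.seq_runs (Prog.seq_runs (Prog.seq_runs (Prog.seq_runs (Prog.seq_runs h1 h2) h3)
    h4) (h5 _)) (h6 _)) (h7 _)) (h8 _)) (h9 _)) (h10 _))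
    (Prog.seq_runs (h11 _) (Prog.seq_runs (h12 _) (h13 _)))
  have hs : singleStk ExpK.x x = expStk x [] [] [] [] := by
    funext i; cases i <;> rfl
  have ht : singleStk ExpK.out (explicitWord k) = expStk [] [] [] [] (explicitWord k) := by
    funext i; cases i <;> rfl
  rw [hs, ht]
  refine key.mono (le_of_eq ?_)
  simp [← hk]
  ring

/-! ### Binary numbers as strings -/

open Computability in
theorem encodeNat_zero : encodeNat 0 = [] := rfl

open Computability in
theorem encodeNat_bit (b : Bool) (n : ℕ) :
    encodeNat (Nat.bit b n) = if (encodeNat n).isEmpty && !b then [] else b :: encodeNat n := by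
  have h : ((Nat.bit b n : ℕ) : Num) = if b then Num.bit1 n else Num.bit0 n := by
    rw [Nat.bit_val, two_mul]
    cases b
    · rw [Bool.toNat_false, Nat.add_zero, Nat.cast_add, Num.bit0_of_bit0]; rfl
    · rw [Bool.toNat_true, Nat.cast_add, Nat.cast_add, Nat.cast_one, Num.bit1_of_bit1]; rfl
  unfold encodeNat
  rw [h]
  rcases (n : Num) with _ | p
  · cases b <;> rfl
  · have := encodePosNum_nonempty p
    cases b
    · simp [Num.bit0, encodeNum, encodePosNum, this]
    · simp [Num.bit1, encodeNum, encodePosNum]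

open Computability in
theorem encodeNat_isEmpty (n : ℕ) : (encodeNat n).isEmpty = decide (n = 0) := by
  by_cases h : n = 0
  · subst h
    rfl
  · simp only [h, decide_false, List.isEmpty_eq_false_iff]
    intro h'
    rw [← decode_encodeNat n, h'] at h
    exact h rfl

/-! ### The strings that the subsets of a paired ground set describe -/

/-- The pairs of bits of a string. -/
def flattenPairs (ps : List (Bool × Bool)) : List Bool := ps.flatMap fun p => [p.1, p.2]

/-- The binary number whose `j`-th bit tells whether a bit of the `j`-th pair is set. -/
def touchVal (ps : List (Bool × Bool)) : ℕ := ps.foldr (fun p v => Nat.bit (p.1 || p.2) v) 0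

/-- Remove the final zeros and the last one from a string; the first component tells whether there
was a one. -/
def unpadAux : List Bool → Bool × List Bool
  | [] => (false, [])
  | b :: l => if (unpadAux l).1 then (true, b :: (unpadAux l).2) else (b, (unpadAux l).2)

/-- Remove the final zeros and the last one from a string. Strings of length less than `k` are
encoded by strings of length `k` in this way. -/
def unpad (l : List Bool) : List Bool := (unpadAux l).2

theorem unpad_pad (y : List Bool) (j : ℕ) : unpad (y ++ true :: List.replicate j false) = y := by
  have h1 : unpadAux (List.replicate j false) = (false, []) := by
    induction j with
    | zero => rfl
    | succ j ih => simp [List.replicate_succ, unpadAux, ih]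
  have h2 : unpadAux (y ++ true :: List.replicate j false) = (true, y) := by
    induction y with
    | nil => simp [unpadAux, h1]
    | cons b y ih => simp [unpadAux, ih]
  rw [unpad, h2]

theorem unpadAux_cons (b : Bool) (l : List Bool) : unpadAux (b :: l) =
    if (unpadAux l).1 then (true, b :: (unpadAux l).2) else (b, (unpadAux l).2) := rfl

theorem length_unpad_le (l : List Bool) : (unpad l).length ≤ l.length - 1 := by
  have h : ((unpadAux l).1 = false → (unpadAux l).2 = []) ∧
      ((unpadAux l).1 = true → (unpadAux l).2.length + 1 ≤ l.length) := by
    induction l with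
    | nil => simp [unpadAux]
    | cons b l ih =>
      unfold unpadAux
      cases h : (unpadAux l).1 <;> simp_all
  unfold unpad
  cases h' : (unpadAux l).1
  · simp [h.1 h']
  · have := h.2 h'
    omega

/-- The strictly concave function `2 ^ (s + f) - 2 ^ f` of the numbers `s` and `f` of ones and
zeros, doubled, with last bit `b` for nonempty sets. -/
def concaveVal (s f : ℕ) (b : Bool) : ℕ :=
  if 2 ^ f * (2 ^ s - 1) = 0 then 0 else Nat.bit b (2 ^ f * (2 ^ s - 1))

/-! ### The machine that answers the value queries -/

/-- The stacks of the machine that answers the value queries, in addition to those of the verifier: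
the input, its three parts, two counters in unary, and the output. -/
inductive OrK
  | inp | x | i | y | t | f | out
  deriving DecidableEq

instance : Fintype OrK := ⟨{.inp, .x, .i, .y, .t, .f, .out}, fun k => by cases k <;> simp⟩

/-- The symbols in which queries are encoded. -/
abbrev QSym : Type := Bool ⊕ (Bool ⊕ Bool)

/-- The alphabets of the stacks. -/
abbrev OrAlph : OrK → Type
  | .inp => QSym
  | .x => Bool
  | .i => Bool
  | .y => Bool
  | .t => Bool
  | .f => Bool
  | .out => Bool

/-- The stacks with the given contents. -/
def orStk (inp : List QSym) (x i y t f out : List Bool) : ∀ k, List (OrAlph k)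
  | .inp => inp
  | .x => x
  | .i => i
  | .y => y
  | .t => t
  | .f => f
  | .out => out

/-- The state of the machine, in addition to that of the verifier: an input symbol, two bits, and a
flag. -/
abbrev Reg : Type := Option QSym × Option Bool × Option Bool × Bool

section
variable {K : Type} {Γ : K → Type} (S : ∀ k, List (Γ k))
  (inp l' : List QSym) (x i y t f out l : List Bool)

/-- The stacks of the verifier together with those of the machine. -/
def allStk : ∀ k, List (joinAlph Γ OrAlph k) := joinStk S (orStk inp x i y t f out)

@[simp] theorem allStk_inl (k : K) : allStk S inp x i y t f out (.inl k) = S k := rfl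
@[simp] theorem allStk_inp : allStk S inp x i y t f out (.inr .inp) = inp := rfl
@[simp] theorem allStk_x : allStk S inp x i y t f out (.inr .x) = x := rfl
@[simp] theorem allStk_i : allStk S inp x i y t f out (.inr .i) = i := rfl
@[simp] theorem allStk_y : allStk S inp x i y t f out (.inr .y) = y := rfl
@[simp] theorem allStk_t : allStk S inp x i y t f out (.inr .t) = t := rfl
@[simp] theorem allStk_f : allStk S inp x i y t f out (.inr .f) = f := rfl
@[simp] theorem allStk_out : allStk S inp x i y t f out (.inr .out) = out := rfl

variable [DecidableEq K]

@[simp] theorem update_allStk_inl (k : K) (l : List (Γ k)) :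
    Function.update (allStk S inp x i y t f out) (.inl k) l =
      allStk (Function.update S k l) inp x i y t f out :=
  update_joinStk_inl _ _ _ _

@[simp] theorem update_allStk_inp :
    Function.update (allStk S inp x i y t f out) (.inr .inp) l' = allStk S l' x i y t f out := by
  refine (update_joinStk_inr _ _ _ _).trans (congrArg (joinStk S) ?_)
  funext k; cases k <;> rfl

@[simp] theorem update_allStk_x :
    Function.update (allStk S inp x i y t f out) (.inr .x) l = allStk S inp l i y t f out := by
  refine (update_joinStk_inr _ _ _ _).trans (congrArg (joinStk S) ?_)
  funext k; cases k <;> rfl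

@[simp] theorem update_allStk_i :
    Function.update (allStk S inp x i y t f out) (.inr .i) l = allStk S inp x l y t f out := by
  refine (update_joinStk_inr _ _ _ _).trans (congrArg (joinStk S) ?_)
  funext k; cases k <;> rfl

@[simp] theorem update_allStk_y :
    Function.update (allStk S inp x i y t f out) (.inr .y) l = allStk S inp x i l t f out := by
  refine (update_joinStk_inr _ _ _ _).trans (congrArg (joinStk S) ?_)
  funext k; cases k <;> rfl

@[simp] theorem update_allStk_t :
    Function.update (allStk S inp x i y t f out) (.inr .t) l = allStk S inp x i y l f out := by
  refine (update_joinStk_inr _ _ _ _).trans (congrArg (joinStk S) ?_)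
  funext k; cases k <;> rfl

@[simp] theorem update_allStk_f :
    Function.update (allStk S inp x i y t f out) (.inr .f) l = allStk S inp x i y t l out := by
  refine (update_joinStk_inr _ _ _ _).trans (congrArg (joinStk S) ?_)
  funext k; cases k <;> rfl

@[simp] theorem update_allStk_out :
    Function.update (allStk S inp x i y t f out) (.inr .out) l = allStk S inp x i y t f l := by
  refine (update_joinStk_inr _ _ _ _).trans (congrArg (joinStk S) ?_)
  funext k; cases k <;> rfl

end

section
variable {tm : FinTM2}

/-- The state at the beginning and at the end of each part of the program, up to the flag `b`. -/
def regState (b : Bool) : tm.σ × Reg := (tm.initialState, none, none, none, b)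

/-- Clear the additional state and leave the program. -/
def regDone : Stmt (joinAlph tm.Γ OrAlph) Unit (tm.σ × Reg) :=
  .load (fun v => (v.1, none, none, none, false)) .halt

@[simp] theorem stepAux_regDone (r : Reg) (T : ∀ k, List (joinAlph tm.Γ OrAlph k)) :
    stepAux regDone ((tm.initialState, r) : tm.σ × Reg) T = ⟨none, regState false, T⟩ := rfl

/-- Put a bit into the state. -/
def readBit (v : tm.σ × Reg) (a : Option Bool) : tm.σ × Reg := (v.1, none, a, none, v.2.2.2.2)

/-- There is a first bit in the state. -/
def hasBit (v : tm.σ × Reg) : Bool := v.2.2.1.isSome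

/-- The first bit in the state. -/
def fstBit (v : tm.σ × Reg) : Bool := v.2.2.1.getD false

/-- The second bit in the state. -/
def sndBit (v : tm.σ × Reg) : Bool := v.2.2.2.1.getD false

/-- Append `g v` as the last bit to the binary number on the output stack. -/
def pushBit (g : tm.σ × Reg → Bool) : Stmt (joinAlph tm.Γ OrAlph) Unit (tm.σ × Reg) :=
  .peek (.inr .out) (fun v a => (v.1, v.2.1, v.2.2.1, v.2.2.2.1, a.isSome))
    (.branch (fun v => v.2.2.2.2 || g v) (.push (.inr .out) g regDone) regDone)

variable (S : ∀ k, List (tm.Γ k)) (inp : List QSym) (x i y t f out : List Bool)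

open Computability in
theorem stepAux_pushBit {g : tm.σ × Reg → Bool} {r : Reg} {b : Bool} (n : ℕ)
    (hg : ∀ c, g (tm.initialState, r.1, r.2.1, r.2.2.1, c) = b) :
    stepAux (pushBit g) (tm.initialState, r) (allStk S inp x i y t f (encodeNat n)) =
      ⟨none, regState false, allStk S inp x i y t f (encodeNat (Nat.bit b n))⟩ := by
  rw [encodeNat_bit]
  unfold pushBit
  simp only [stepAux, allStk_out, hg, update_allStk_out]
  cases h : encodeNat n <;> cases b <;> simp

/-- The bit that a symbol contributes to the first part of a query. -/
def symFst : Option QSym → Option Bool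
  | some (.inl b) => some b
  | _ => none

/-- The bit that a symbol contributes to the second part of a query. -/
def symSnd : Option QSym → Option Bool
  | some (.inr (.inl b)) => some b
  | _ => none

/-- The bit that a symbol contributes to the third part of a query. -/
def symThd : Option QSym → Option Bool
  | some (.inr (.inr b)) => some b
  | _ => none

/-- Push the bit of an input symbol onto the stack for the part of the query that it belongs to. -/
def parseSym : Stmt (joinAlph tm.Γ OrAlph) Unit (tm.σ × Reg) :=
  .branch (fun v => (symFst v.2.1).isSome)
    (.push (.inr .x) (fun v => (symFst v.2.1).getD false) regDone)
    (.branch (fun v => (symSnd v.2.1).isSome)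
      (.push (.inr .i) (fun v => (symSnd v.2.1).getD false) regDone)
      (.push (.inr .y) (fun v => (symThd v.2.1).getD false) regDone))

/-- Distribute the three parts of the input to three stacks. -/
abbrev parse : Prog (joinAlph tm.Γ OrAlph) (tm.σ × Reg) :=
  .loop (.inr .inp) (fun v a => (v.1, a, none, none, v.2.2.2.2)) (fun v => v.2.1.isSome)
    (.atom parseSym)

theorem parse_runs (l₁ l₂ l₃ : List Bool) :
    parse.Runs (regState (tm := tm) false)
      (allStk S (l₁.map Sum.inl ++ (l₂.map Sum.inl ++ l₃.map Sum.inr).map Sum.inr) [] [] [] t f out)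
      (regState false) (allStk S [] l₁.reverse l₂.reverse l₃.reverse t f out)
      ((l₁.length + (l₂.length + l₃.length)) * 2 + 1) := by
  have h := Prog.loop_runs_list (k := (.inr .inp : tm.K ⊕ OrK))
    (u := fun (v : tm.σ × Reg) (a : Option QSym) => (v.1, a, none, none, v.2.2.2.2))
    (c := fun v => v.2.1.isSome) (P := .atom parseSym)
    (V := fun _ => regState false) (T := fun d l => allStk S l (d.filterMap fun a => symFst (some a))
      (d.filterMap fun a => symSnd (some a)) (d.filterMap fun a => symThd (some a)) t f out) (b := 1)
    (fun _ _ => rfl) (fun _ => rfl) (fun _ _ => rfl)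
    (fun d a l => Prog.atom_runs (by
      rcases a with b | b | b <;> simp [parseSym, stepAux, symFst, symSnd, symThd, regState]))
    (l₁.map Sum.inl ++ (l₂.map Sum.inl ++ l₃.map Sum.inr).map Sum.inr) []
  simp [List.filterMap_map, Function.comp_def, symFst, symSnd, symThd] at h ⊢
  exact h

/-- Empty the stack of the first part of the query. -/
abbrev clearFst : Prog (joinAlph tm.Γ OrAlph) (tm.σ × Reg) :=
  .loop (.inr .x) readBit hasBit (.atom regDone)

theorem clearFst_runs :
    clearFst.Runs (regState (tm := tm) false) (allStk S inp x i y t f out)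
      (regState false) (allStk S inp [] i y t f out) (x.length * 2 + 1) :=
  Prog.loop_runs (k := (.inr .x : tm.K ⊕ OrK)) (u := readBit (tm := tm)) (c := hasBit)
    (P := .atom regDone) (v := regState false) (b := 1) (fun _ l => allStk S inp l i y t f out)
    (fun _ _ => rfl) rfl rfl (fun _ => rfl)
    (fun _ _ _ => Prog.atom_runs (by rw [update_allStk_x]; rfl)) x 0

/-- Append the bit `b` to the output for each symbol on the first counter, which is emptied. -/
abbrev shiftT (b : Bool) : Prog (joinAlph tm.Γ OrAlph) (tm.σ × Reg) :=
  .loop (.inr .t) readBit hasBit (.atom (pushBit fun _ => b))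

/-- Append the bit `b` to the output for each symbol on the second counter, which is emptied. -/
abbrev shiftF (b : Bool) : Prog (joinAlph tm.Γ OrAlph) (tm.σ × Reg) :=
  .loop (.inr .f) readBit hasBit (.atom (pushBit fun _ => b))

open Computability in
theorem shiftT_runs (b : Bool) (n : ℕ) :
    (shiftT b).Runs (regState (tm := tm) false) (allStk S inp x i y t f (encodeNat n))
      (regState false) (allStk S inp x i y [] f (encodeNat ((Nat.bit b)^[t.length] n)))
      (t.length * 2 + 1) := by
  have h := Prog.loop_runs (k := (.inr .t : tm.K ⊕ OrK)) (u := readBit (tm := tm)) (c := hasBit)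
    (P := .atom (pushBit fun _ => b)) (v := regState false) (b := 1)
    (fun j l => allStk S inp x i y l f (encodeNat ((Nat.bit b)^[j] n)))
    (fun _ _ => rfl) rfl rfl (fun _ => rfl)
    (fun j a l => Prog.atom_runs (by
      rw [update_allStk_t, Function.iterate_succ_apply']
      exact stepAux_pushBit _ _ _ _ _ _ _ _ fun _ => rfl)) t 0
  simpa using h

open Computability in
theorem shiftF_runs (b : Bool) (n : ℕ) :
    (shiftF b).Runs (regState (tm := tm) false) (allStk S inp x i y t f (encodeNat n))
      (regState false) (allStk S inp x i y t [] (encodeNat ((Nat.bit b)^[f.length] n)))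
      (f.length * 2 + 1) := by
  have h := Prog.loop_runs (k := (.inr .f : tm.K ⊕ OrK)) (u := readBit (tm := tm)) (c := hasBit)
    (P := .atom (pushBit fun _ => b)) (v := regState false) (b := 1)
    (fun j l => allStk S inp x i y t l (encodeNat ((Nat.bit b)^[j] n)))
    (fun _ _ => rfl) rfl rfl (fun _ => rfl)
    (fun j a l => Prog.atom_runs (by
      rw [update_allStk_f, Function.iterate_succ_apply']
      exact stepAux_pushBit _ _ _ _ _ _ _ _ fun _ => rfl)) f 0
  simpa using h

/-- Read the next bit of the set as the second bit. -/
def readSnd (v : tm.σ × Reg) (a : Option Bool) : tm.σ × Reg :=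
  (v.1, none, v.2.2.1, a, v.2.2.2.2)

/-- Append the disjunction of a pair of bits to the output, and count the bits. -/
def touchPair : Stmt (joinAlph tm.Γ OrAlph) Unit (tm.σ × Reg) :=
  .pop (.inr .y) readSnd <| .push (.inr .t) (fun _ => true) <| .push (.inr .t) (fun _ => true) <|
    pushBit fun v => sndBit v || fstBit v

/-- For each pair of bits, append their disjunction to the output, and count the bits. -/
abbrev touchLoop : Prog (joinAlph tm.Γ OrAlph) (tm.σ × Reg) :=
  .loop (.inr .y) readBit hasBit (.atom touchPair)

open Computability in
theorem touchLoop_runs (ps : List (Bool × Bool)) : ∀ (t : List Bool) (n : ℕ),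
    touchLoop.Runs (regState (tm := tm) false)
      (allStk S inp x i (ps.flatMap fun p => [p.2, p.1]) t f (encodeNat n)) (regState false)
      (allStk S inp x i [] (un (2 * ps.length) ++ t) f
        (encodeNat (ps.foldl (fun v p => Nat.bit (p.1 || p.2) v) n))) (ps.length * 2 + 1) := by
  induction ps with
  | nil =>
    intro t n
    exact Prog.loop_runs_nil (v := regState false) rfl rfl
  | cons p ps ih =>
    intro t n
    have h := Prog.loop_runs_cons (k := (.inr .y : tm.K ⊕ OrK)) (u := readBit (tm := tm))
      (c := hasBit) (v := regState false)
      (S := allStk S inp x i (p.2 :: p.1 :: ps.flatMap fun p => [p.2, p.1]) t f (encodeNat n))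
      (allStk_y _ _ _ _ _ _ _ _) rfl (Prog.atom_runs (q := touchPair) (by
          rw [update_allStk_y, touchPair, stepAux, allStk_y, stepAux, stepAux, update_allStk_y,
            allStk_t, update_allStk_t, allStk_t, update_allStk_t]
          exact stepAux_pushBit (b := p.1 || p.2) _ _ _ _ _ _ _ _ fun _ => rfl))
      (ih (true :: true :: t) (Nat.bit (p.1 || p.2) n))
    have hun : un (2 * ps.length) ++ true :: true :: t = un (2 * (p :: ps).length) ++ t := by
      rw [List.length_cons, mul_add, un, un, List.replicate_add, List.append_assoc]
      rfl
    rw [hun] at h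
    exact h.mono (by rw [List.length_cons]; omega)

/-- Leave the program with the flag unchanged. -/
def keepDone : Stmt (joinAlph tm.Γ OrAlph) Unit (tm.σ × Reg) :=
  .load (fun v => (v.1, none, none, none, v.2.2.2.2)) .halt

/-- Count the bit `g v` by one of the two counters. -/
def countBit (g : tm.σ × Reg → Bool) (q : Stmt (joinAlph tm.Γ OrAlph) Unit (tm.σ × Reg)) :
    Stmt (joinAlph tm.Γ OrAlph) Unit (tm.σ × Reg) :=
  .branch g (.push (.inr .t) (fun _ => true) q) (.push (.inr .f) (fun _ => true) q)

theorem stepAux_countBit (g : tm.σ × Reg → Bool)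
    (q : Stmt (joinAlph tm.Γ OrAlph) Unit (tm.σ × Reg)) (v : tm.σ × Reg) (j j' : ℕ) :
    stepAux (countBit g q) v (allStk S inp x i y (un j) (un j') out) =
      stepAux q v (allStk S inp x i y (un ([g v].count true + j)) (un ([g v].count false + j'))
        out) := by
  unfold countBit
  cases h : g v <;> simp [stepAux, h, Nat.add_comm 1, List.replicate_succ]

/-- Count the bits of a pair, and push the first one onto the input stack of the verifier, unless
the flag tells that there has not been a one among the first bits. -/
def decodePair (e₀ : tm.Γ tm.k₀ ≃ Bool ⊕ Bool) :
    Stmt (joinAlph tm.Γ OrAlph) Unit (tm.σ × Reg) :=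
  .pop (.inr .y) readSnd <| countBit fstBit <| countBit sndBit <| .branch (fun v => v.2.2.2.2)
    (.push (.inl tm.k₀) (fun v => e₀.symm (.inr (fstBit v))) keepDone)
    (.load (fun v => (v.1, none, none, none, fstBit v)) .halt)

/-- Decode the certificate that a set stands for, and count the elements and non-elements. -/
abbrev decodeLoop (e₀ : tm.Γ tm.k₀ ≃ Bool ⊕ Bool) : Prog (joinAlph tm.Γ OrAlph) (tm.σ × Reg) :=
  .loop (.inr .y) readBit hasBit (.atom (decodePair e₀))

theorem decodeLoop_runs (e₀ : tm.Γ tm.k₀ ≃ Bool ⊕ Bool) (ps : List (Bool × Bool)) :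
    ∀ (j j' : ℕ) (l : List Bool),
    (decodeLoop e₀).Runs (regState (unpadAux l).1)
      (allStk (singleStk tm.k₀ ((unpadAux l).2.map fun b => e₀.symm (.inr b))) inp x i
        (ps.flatMap fun p => [p.2, p.1]) (un j) (un j') out)
      (regState (unpadAux ((ps.map Prod.snd).reverse ++ l)).1)
      (allStk (singleStk tm.k₀ ((unpadAux ((ps.map Prod.snd).reverse ++ l)).2.map
        fun b => e₀.symm (.inr b))) inp x i []
        (un ((flattenPairs ps).count true + j)) (un ((flattenPairs ps).count false + j')) out)
      (ps.length * 2 + 1) := by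
  induction ps with
  | nil =>
    intro j j' l
    have h := Prog.loop_runs_nil (k := (.inr .y : tm.K ⊕ OrK)) (u := readBit (tm := tm))
      (c := hasBit) (P := .atom (decodePair e₀)) (v := regState (unpadAux l).1)
      (S := allStk (singleStk tm.k₀ ((unpadAux l).2.map fun b => e₀.symm (.inr b))) inp x i
        [] (un j) (un j') out) rfl rfl
    simp only [flattenPairs, List.flatMap_nil, List.map_nil, List.reverse_nil, List.nil_append,
      List.count_nil, Nat.zero_add, List.length_nil, Nat.zero_mul]
    exact h
  | cons p ps ih =>
    intro j j' l
    have h := Prog.loop_runs_cons (k := (.inr .y : tm.K ⊕ OrK)) (u := readBit (tm := tm))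
      (c := hasBit) (v := regState (unpadAux l).1)
      (S := allStk (singleStk tm.k₀ ((unpadAux l).2.map fun b => e₀.symm (.inr b))) inp x i
        (p.2 :: p.1 :: ps.flatMap fun p => [p.2, p.1]) (un j) (un j') out)
      (allStk_y _ _ _ _ _ _ _ _) rfl (Prog.atom_runs (q := decodePair e₀) (by
          rw [update_allStk_y, decodePair, stepAux, allStk_y, update_allStk_y, stepAux_countBit,
            stepAux_countBit, unpadAux_cons]
          cases hl : (unpadAux l).1 <;>
            simp [stepAux, keepDone, regState, readBit, readSnd, fstBit, sndBit]))
      (ih ([p.1].count true + ([p.2].count true + j)) ([p.1].count false + ([p.2].count false + j'))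
        (p.2 :: l))
    have hc : ∀ b j, (flattenPairs ps).count b + ([p.1].count b + ([p.2].count b + j)) =
        (flattenPairs (p :: ps)).count b + j := by
      intro b j
      have : flattenPairs (p :: ps) = [p.1] ++ ([p.2] ++ flattenPairs ps) := rfl
      rw [this, List.count_append, List.count_append]
      ring
    rw [hc, hc] at h
    rw [List.map_cons, List.reverse_cons, List.append_assoc]
    exact h.mono (by rw [List.length_cons]; omega)

/-- Push the bits of the first part of the query onto the input stack of the verifier. -/
abbrev sendFst (e₀ : tm.Γ tm.k₀ ≃ Bool ⊕ Bool) : Prog (joinAlph tm.Γ OrAlph) (tm.σ × Reg) :=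
  .loop (.inr .x) readBit hasBit
    (.atom (.push (.inl tm.k₀) (fun v => e₀.symm (.inl (fstBit v))) regDone))

theorem sendFst_runs (e₀ : tm.Γ tm.k₀ ≃ Bool ⊕ Bool) (z : List (tm.Γ tm.k₀)) :
    (sendFst e₀).Runs (regState false) (allStk (singleStk tm.k₀ z) inp x i y t f out)
      (regState false) (allStk (singleStk tm.k₀ ((x.reverse.map fun b => e₀.symm (.inl b)) ++ z))
        inp [] i y t f out) (x.length * 2 + 1) := by
  have h := Prog.loop_runs_list (k := (.inr .x : tm.K ⊕ OrK)) (u := readBit (tm := tm))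
    (c := hasBit) (P := .atom (.push (.inl tm.k₀) (fun v => e₀.symm (.inl (fstBit v))) regDone))
    (V := fun _ => regState false) (T := fun d l =>
      allStk (singleStk tm.k₀ ((d.map fun b => e₀.symm (.inl b)) ++ z)) inp l i y t f out) (b := 1)
    (fun _ _ => rfl) (fun _ => rfl) (fun _ _ => rfl)
    (fun d a l => Prog.atom_runs (by
      simp [stepAux, regState, readBit, fstBit])) x []
  simp only [List.append_nil] at h
  exact h

/-- Read the answer of the verifier. Append its negation to the output, unless this is empty. -/
def appendAnswer (e₁ : tm.Γ tm.k₁ ≃ Bool) : Stmt (joinAlph tm.Γ OrAlph) Unit (tm.σ × Reg) :=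
  .pop (.inl tm.k₁) (fun v a => (v.1, none, none, a.map e₁, false)) <|
    .peek (.inr .out) (fun v a => (v.1, v.2.1, v.2.2.1, v.2.2.2.1, a.isSome)) <|
      .branch (fun v => v.2.2.2.2) (.push (.inr .out) (fun v => !sndBit v) regDone) regDone

open Computability in
theorem stepAux_appendAnswer (e₁ : tm.Γ tm.k₁ ≃ Bool) (b : Bool) (n : ℕ) :
    stepAux (appendAnswer e₁) (regState false)
      (allStk (singleStk tm.k₁ [e₁.symm b]) inp x i y t f (encodeNat n)) =
      ⟨none, regState false, allStk (fun _ => []) inp x i y t f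
        (encodeNat (if n = 0 then 0 else Nat.bit (!b) n))⟩ := by
  have h1 := encodeNat_isEmpty n
  have h2 := encodeNat_bit (!b) n
  by_cases hn : n = 0
  · subst hn
    simp [appendAnswer, stepAux, regState, encodeNat_zero, singleStk_nil]
  · simp only [hn, decide_false] at h1
    obtain ⟨a, l, hl⟩ : ∃ a l, encodeNat n = a :: l := by
      cases h : encodeNat n with
      | nil => simp [h] at h1
      | cons a l => exact ⟨a, l, rfl⟩
    rw [if_neg hn, h2, hl]
    simp [appendAnswer, stepAux, regState, singleStk_nil, sndBit]

/-- Read the index of the queried function, which has a second bit if and only if it is `2`. -/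
def readIndex : Stmt (joinAlph tm.Γ OrAlph) Unit (tm.σ × Reg) :=
  .pop (.inr .i) readBit <| .pop (.inr .i) readSnd .halt

end

theorem iterate_bit_false (j n : ℕ) : (Nat.bit false)^[j] n = 2 ^ j * n := by
  induction j with
  | zero => simp
  | succ j ih =>
    rw [Function.iterate_succ_apply', ih, Nat.bit_val, pow_succ, Bool.toNat_false]
    ring

theorem iterate_bit_true (j : ℕ) : (Nat.bit true)^[j] 0 = 2 ^ j - 1 := by
  induction j with
  | zero => simp
  | succ j ih =>
    have := Nat.one_le_two_pow (n := j)
    rw [Function.iterate_succ_apply', ih, Nat.bit_val, pow_succ, Bool.toNat_true]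
    omega

/-- The value of the `i`-th function for the set that the string `flattenPairs ps` describes. -/
def oracleVal (V : List Bool × List Bool → Bool) (x : List Bool) (i : ℕ)
    (ps : List (Bool × Bool)) : ℕ :=
  if i < 2 then 2 ^ (2 * ps.length + 1) * touchVal ps
  else concaveVal ((flattenPairs ps).count true) ((flattenPairs ps).count false)
    (!V (x, unpad (ps.map Prod.snd)))

theorem length_flattenPairs (ps : List (Bool × Bool)) :
    (flattenPairs ps).length = 2 * ps.length := by
  induction ps with
  | nil => rfl
  | cons p ps ih =>
    have : flattenPairs (p :: ps) = p.1 :: p.2 :: flattenPairs ps := rfl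
    rw [this, List.length_cons, List.length_cons, List.length_cons, ih]
    ring

theorem reverse_flattenPairs (ps : List (Bool × Bool)) :
    (flattenPairs ps).reverse = ps.reverse.flatMap fun p => [p.2, p.1] := by
  simp [flattenPairs, List.reverse_flatMap, Function.comp_def]

theorem count_flattenPairs_reverse (ps : List (Bool × Bool)) (b : Bool) :
    (flattenPairs ps.reverse).count b = (flattenPairs ps).count b :=
  ((List.reverse_perm ps).flatMap_right _).count_eq b

section
variable {V : List Bool × List Bool → Bool}

open Computability

/-- The branch of the program for the queries to the first two functions. The bits of the set are on
the stack in reverse, so that the highest bits of the output come first. -/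
abbrev touchProg (tm : FinTM2) : Prog (joinAlph tm.Γ OrAlph) (tm.σ × Reg) :=
  ((touchLoop.seq (shiftT false)).seq (.atom (pushBit fun _ => false))).seq clearFst

theorem touchProg_runs {tm : FinTM2} (S : ∀ k, List (tm.Γ k)) (a b : Option Bool) (x : List Bool)
    (ps : List (Bool × Bool)) :
    (touchProg tm).Runs (tm.initialState, none, a, b, false)
      (allStk S [] x [] (flattenPairs ps).reverse [] [] []) (regState false)
      (allStk S [] [] [] [] [] [] (encodeNat (2 ^ (2 * ps.length + 1) * touchVal ps)))
      (6 * ps.length + 2 * x.length + 4) := by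
  have h1 := touchLoop_runs S [] x [] [] ps.reverse [] 0
  have h2 := shiftT_runs S [] x [] [] (un (2 * ps.reverse.length)) [] false
    (ps.reverse.foldl (fun v p => Nat.bit (p.1 || p.2) v) 0)
  have h3 := clearFst_runs S [] x [] [] [] [] (encodeNat (2 ^ (2 * ps.length + 1) * touchVal ps))
  simp only [List.append_nil, List.length_replicate, List.length_reverse, List.foldl_reverse,
    ← reverse_flattenPairs] at h1 h2
  have h4 : (Prog.atom (pushBit fun _ => false)).Runs (regState (tm := tm) false)
      (allStk S [] x [] [] [] [] (encodeNat ((Nat.bit false)^[2 * ps.length] (touchVal ps))))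
      (regState false)
      (allStk S [] x [] [] [] [] (encodeNat (2 ^ (2 * ps.length + 1) * touchVal ps))) 1 := by
    refine Prog.atom_runs ?_
    rw [← iterate_bit_false, Function.iterate_succ_apply']
    exact stepAux_pushBit S [] x [] [] [] [] _ fun _ => rfl
  have h5 := Prog.loop_runs_congr (v := regState false)
    (w := (tm.initialState, none, a, b, false)) (fun _ => rfl) h1
  exact (Prog.seq_runs (Prog.seq_runs (Prog.seq_runs h5 h2) h4) h3).mono (by omega)

/-- The branch of the program for the queries to the third function: it prepares the input of the
verifier, writes all bits of the output but the last, and calls the verifier for that one. -/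
abbrev concaveProg (h : TM2ComputableInPolyTime
    (encodingProd (encodingList Bool) (encodingList Bool)).encode encodeBool V) :
    Prog (joinAlph h.tm.Γ OrAlph) (h.tm.σ × Reg) :=
  ((((((decodeLoop h.inputAlphabet).seq (.atom regDone)).seq (sendFst h.inputAlphabet)).seq
    (shiftT true)).seq (shiftF false)).seq (.ofMachine h.tm OrAlph Reg)).seq
    (.atom (appendAnswer h.outputAlphabet))

theorem concaveProg_runs (h : TM2ComputableInPolyTime
    (encodingProd (encodingList Bool) (encodingList Bool)).encode encodeBool V)
    (a b : Option Bool) (x : List Bool) (ps : List (Bool × Bool)) :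
    (concaveProg h).Runs (h.tm.initialState, none, a, b, false)
      (allStk (fun _ => []) [] x.reverse [] (flattenPairs ps).reverse [] [] []) (regState false)
      (allStk (fun _ => []) [] [] [] [] [] [] (encodeNat (concaveVal
        ((flattenPairs ps).count true) ((flattenPairs ps).count false)
        (!V (x, unpad (ps.map Prod.snd))))))
      (6 * ps.length + 2 * x.length + h.time.eval (x.length + ps.length) + 6) := by
  set s := (flattenPairs ps).count true with hs
  set f := (flattenPairs ps).count false with hf
  have hsf : s + f = 2 * ps.length := by
    rw [← length_flattenPairs, hs, hf]
    exact List.count_true_add_count_false _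
  have h1 := decodeLoop_runs (tm := h.tm) [] x.reverse [] [] h.inputAlphabet ps.reverse 0 0 []
  have h2 : (Prog.atom regDone).Runs (regState (tm := h.tm) (unpadAux (ps.map Prod.snd)).1)
      (allStk (singleStk h.tm.k₀ ((unpad (ps.map Prod.snd)).map
        fun b => h.inputAlphabet.symm (.inr b))) [] x.reverse [] [] (un s) (un f) [])
      (regState false) _ 1 := Prog.atom_runs rfl
  have h3 := sendFst_runs (tm := h.tm) [] x.reverse [] [] (un s) (un f) [] h.inputAlphabet
    ((unpad (ps.map Prod.snd)).map fun b => h.inputAlphabet.symm (.inr b))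
  set S := singleStk h.tm.k₀ ((x.reverse.reverse.map fun b => h.inputAlphabet.symm (.inl b)) ++
    (unpad (ps.map Prod.snd)).map fun b => h.inputAlphabet.symm (.inr b)) with hS
  have h4 := shiftT_runs S [] [] [] [] (un s) (un f) true 0
  have h5 := shiftF_runs S [] [] [] [] [] (un f) false (2 ^ s - 1)
  have h6 := Prog.ofMachine_runs (h.outputsFun (x, unpad (ps.map Prod.snd)))
    (K' := OrK) (Γ' := OrAlph) (ρ := Reg) (none, none, none, false)
    (orStk [] [] [] [] [] [] (encodeNat (2 ^ f * (2 ^ s - 1))))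
  have h7 := Prog.atom_runs (stepAux_appendAnswer (tm := h.tm) [] [] [] [] [] [] h.outputAlphabet
    (V (x, unpad (ps.map Prod.snd))) (2 ^ f * (2 ^ s - 1)))
  have hz := length_unpad_le (ps.map Prod.snd)
  rw [List.length_map] at hz
  have henc : ((encodingProd (encodingList Bool) (encodingList Bool)).encode
      (x, unpad (ps.map Prod.snd))) = x.map .inl ++ (unpad (ps.map Prod.snd)).map .inr := rfl
  have hin : singleStk h.tm.k₀ (((encodingProd (encodingList Bool) (encodingList Bool)).encode
      (x, unpad (ps.map Prod.snd))).map h.inputAlphabet.invFun) = S := by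
    rw [henc, hS, List.map_append, List.map_map, List.map_map, List.reverse_reverse]
    rfl
  have ht : ((encodingProd (encodingList Bool) (encodingList Bool)).encode
      (x, unpad (ps.map Prod.snd))).length ≤ x.length + ps.length := by
    rw [henc, List.length_append, List.length_map, List.length_map]
    omega
  have ht' := eval_le_eval h.time ht
  rw [hin] at h6
  simp only [List.length_replicate, iterate_bit_true, iterate_bit_false] at h4 h5
  simp only [count_flattenPairs_reverse, List.map_reverse, List.reverse_reverse, List.append_nil,
    List.length_reverse, Nat.add_zero, ← reverse_flattenPairs, ← hs, ← hf] at h1 h3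
  have hnil : singleStk h.tm.k₀ ((unpadAux []).2.map fun b => h.inputAlphabet.symm (.inr b)) =
      fun _ => [] := singleStk_nil _
  rw [hnil] at h1
  have h8 := Prog.loop_runs_congr (v := regState false)
    (w := (h.tm.initialState, none, a, b, false)) (fun _ => rfl) h1
  have h9 := Prog.seq_runs (Prog.seq_runs (Prog.seq_runs (Prog.seq_runs (Prog.seq_runs
    (Prog.seq_runs h8 h2) h3) h4) h5) h6) h7
  refine Prog.Runs.mono h9 ?_
  omega

/-- The program that answers the value queries. The index in binary has a second bit only for the
third function. -/
abbrev oracleProg (h : TM2ComputableInPolyTime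
    (encodingProd (encodingList Bool) (encodingList Bool)).encode encodeBool V) :
    Prog (joinAlph h.tm.Γ OrAlph) (h.tm.σ × Reg) :=
  (parse.seq (.atom readIndex)).seq
    (.ite (fun v => v.2.2.2.1.isSome) (concaveProg h) (touchProg h.tm))

theorem oracleProg_runs (h : TM2ComputableInPolyTime
    (encodingProd (encodingList Bool) (encodingList Bool)).encode encodeBool V)
    (x : List Bool) {i : ℕ} (hi : i < 3) (ps : List (Bool × Bool)) :
    (oracleProg h).Runs (regState false)
      (allStk (fun _ => []) (x.map Sum.inl ++
        ((encodeNat i).map Sum.inl ++ (flattenPairs ps).map Sum.inr).map Sum.inr) [] [] [] [] [] [])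
      (regState false)
      (allStk (fun _ => []) [] [] [] [] [] [] (encodeNat (oracleVal V x i ps)))
      (10 * (x.length + ((encodeNat i).length + (flattenPairs ps).length)) +
        h.time.eval (x.length + ((encodeNat i).length + (flattenPairs ps).length)) + 10) := by
  have hlen := length_flattenPairs ps
  have h1 := parse_runs (tm := h.tm) (fun _ => []) [] [] [] x (encodeNat i) (flattenPairs ps)
  have h2 : (Prog.atom readIndex).Runs (regState (tm := h.tm) false)
      (allStk (fun _ => []) [] x.reverse (encodeNat i).reverse (flattenPairs ps).reverse [] [] [])
      (h.tm.initialState, none, (encodeNat i).reverse.head?, (encodeNat i).reverse.tail.head?, false)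
      (allStk (fun _ => []) [] x.reverse [] (flattenPairs ps).reverse [] [] []) 1 := by
    refine Prog.atom_runs ?_
    interval_cases i <;>
    · rw [readIndex, stepAux, allStk_i, update_allStk_i, stepAux, allStk_i, update_allStk_i]
      rfl
  have h3 := eval_le_eval h.time (show x.length + ps.length ≤
    x.length + ((encodeNat i).length + (flattenPairs ps).length) by omega)
  rcases Nat.lt_or_ge i 2 with hi2 | hi2
  · have h4 := Prog.ite_runs_false (c := fun v : h.tm.σ × Reg => v.2.2.2.1.isSome)
      (P := concaveProg h) (by interval_cases i <;> rfl)
      (touchProg_runs (tm := h.tm) (fun _ => []) (encodeNat i).reverse.head?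
        (encodeNat i).reverse.tail.head? x.reverse ps)
    rw [List.length_reverse] at h4
    rw [oracleVal, if_pos hi2]
    exact (Prog.seq_runs (Prog.seq_runs h1 h2) h4).mono (by omega)
  · have h4 := Prog.ite_runs_true (c := fun v : h.tm.σ × Reg => v.2.2.2.1.isSome)
      (Q := touchProg h.tm) (by interval_cases i; rfl)
      (concaveProg_runs h (encodeNat i).reverse.head? (encodeNat i).reverse.tail.head? x ps)
    rw [oracleVal, if_neg (by omega)]
    exact (Prog.seq_runs (Prog.seq_runs h1 h2) h4).mono (by omega)

end

theorem singleStk_inp {K : Type} [DecidableEq K] {Γ : K → Type} (l : List QSym) :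
    singleStk (Γ := joinAlph Γ OrAlph) (.inr .inp) l =
      allStk (fun _ => []) l [] [] [] [] [] [] := by
  funext k
  rcases k with k | k
  · rfl
  · cases k <;> rfl

theorem singleStk_out {K : Type} [DecidableEq K] {Γ : K → Type} (l : List Bool) :
    singleStk (Γ := joinAlph Γ OrAlph) (.inr .out) l =
      allStk (fun _ => []) [] [] [] [] [] [] l := by
  funext k
  rcases k with k | k
  · rfl
  · cases k <;> rfl

/-! ### The reduction -/

/-- The bits that tell which elements of the pairs belong to `Y`. -/
def pairBits {k : ℕ} (Y : Finset (Fin (k * 2))) : List (Bool × Bool) :=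
  List.ofFn fun j => (decide (pairFst j ∈ Y), decide (pairSnd j ∈ Y))

theorem charVec_eq_flattenPairs {k : ℕ} (Y : Finset (Fin (k * 2))) :
    charVec Y = flattenPairs (pairBits Y) := by
  rw [charVec, List.ofFn_mul, flattenPairs, pairBits, List.flatMap_def, List.map_ofFn]
  congr 2

theorem touchVal_ofFn {k : ℕ} (f : Fin k → Bool × Bool) :
    touchVal (List.ofFn f) = ∑ j, if (f j).1 || (f j).2 then 2 ^ (j : ℕ) else 0 := by
  induction k with
  | zero => simp [touchVal]
  | succ k ih =>
    have h : touchVal (List.ofFn f) =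
        Nat.bit ((f 0).1 || (f 0).2) (touchVal (List.ofFn fun j => f j.succ)) := by
      rw [List.ofFn_succ]
      rfl
    rw [h, ih, Nat.bit_val, Fin.sum_univ_succ, Finset.mul_sum, Nat.add_comm]
    congr 1
    · cases (f 0).1 || (f 0).2 <;> simp
    · refine Finset.sum_congr rfl fun j _ => ?_
      split_ifs
      · rw [Fin.val_succ, pow_succ']
      · rfl

/-- The weights of the pairs, for which every pair outweighs the third function. -/
def pairWeight (k : ℕ) (j : Fin k) : ℕ := 2 ^ (2 * k + 1 + j)

theorem pairWeight_pos (k : ℕ) (j : Fin k) : 0 < pairWeight k j := by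
  unfold pairWeight; positivity

theorem touchWeight_pairWeight {k : ℕ} (Y : Finset (Fin (k * 2))) :
    touchWeight (pairWeight k) Y = 2 ^ (2 * k + 1) * touchVal (pairBits Y) := by
  rw [pairBits, touchVal_ofFn, touchWeight, Finset.mul_sum]
  refine Finset.sum_congr rfl fun j _ => ?_
  simp only [pairWeight, Bool.or_eq_true, decide_eq_true_eq, mul_ite, mul_zero, ← pow_add]

theorem sum_pairWeight (k : ℕ) : ∑ j, pairWeight k j = 2 ^ (2 * k + 1) * (2 ^ k - 1) := by
  have h : ∑ j : Fin k, 2 ^ (j : ℕ) = 2 ^ k - 1 := by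
    rw [Fin.sum_univ_eq_sum_range (fun i => 2 ^ i) k, Nat.geomSum_eq le_rfl]
    simp
  rw [← h, Finset.mul_sum]
  exact Finset.sum_congr rfl fun j _ => pow_add _ _ _

theorem concaveVal_add {s n : ℕ} (h : s ≤ n) (b : Bool) :
    concaveVal s (n - s) b + 2 * 2 ^ (n - s) = 2 * 2 ^ n + if s = 0 then 0 else b.toNat := by
  have h1 : 2 ^ n = 2 ^ (n - s) * 2 ^ s := by rw [← pow_add]; congr 1; omega
  have h2 : 0 < 2 ^ (n - s) := by positivity
  rcases Nat.eq_zero_or_pos s with rfl | hs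
  · simp [concaveVal]
  · have h4 : 0 < 2 ^ s - 1 := Nat.sub_pos_of_lt (Nat.one_lt_two_pow (by omega))
    have h5 : 2 ^ (n - s) * (2 ^ s - 1) ≠ 0 := by positivity
    rw [concaveVal, if_neg h5, if_neg (by omega), Nat.bit_val, h1]
    obtain ⟨a, ha⟩ : ∃ a, 2 ^ s = a + 1 :=
      ⟨2 ^ s - 1, (Nat.sub_add_cancel Nat.one_le_two_pow).symm⟩
    rw [ha, Nat.add_sub_cancel]
    ring

/-- The function `2 ^ (n + 1) - 2 ^ (n - |Y| + 1)` is so concave in the size of `Y` that it remains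
monotone and submodular when the values at arbitrary nonempty sets are increased by one. -/
theorem isPositivePolymatroid_concaveVal {n : ℕ} (r : Finset (Fin n) → Bool) :
    IsPositivePolymatroid fun Y => (concaveVal Y.card (n - Y.card) (r Y) : ℝ) := by
  have hcard : ∀ Y : Finset (Fin n), Y.card ≤ n := fun Y => by
    simpa using Finset.card_le_univ Y
  have hval := fun Y : Finset (Fin n) => concaveVal_add (hcard Y) (r Y)
  have hle : ∀ Y : Finset (Fin n), (if Y.card = 0 then 0 else (r Y).toNat) ≤ 1 := fun Y => by
    split_ifs
    · exact Nat.zero_le _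
    · exact Bool.toNat_le _
  refine .of_nat (by simp [concaveVal]) (fun A B h => ?_) (fun A B => ?_) (fun A hA => ?_)
  · rcases eq_or_ssubset_of_subset h with rfl | h
    · exact le_rfl
    · have h1 := Finset.card_lt_card h
      have h2 : 2 ^ (n - B.card + 1) ≤ 2 ^ (n - A.card) :=
        Nat.pow_le_pow_right two_pos (by have := hcard B; omega)
      rw [pow_succ] at h2
      have h3 : 0 < 2 ^ (n - B.card) := by positivity
      have := hval A
      have := hval B
      have := hle A
      omega
  · by_cases hAB : A ⊆ B
    · rw [Finset.union_eq_right.2 hAB, Finset.inter_eq_left.2 hAB, Nat.add_comm]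
    by_cases hBA : B ⊆ A
    · rw [Finset.union_eq_left.2 hBA, Finset.inter_eq_right.2 hBA]
    have h1 := Finset.card_union_add_card_inter A B
    have h2 : (A ∩ B).card < A.card :=
      Finset.card_lt_card ⟨Finset.inter_subset_left, fun h => hAB (h.trans Finset.inter_subset_right)⟩
    have h3 : (A ∩ B).card < B.card :=
      Finset.card_lt_card ⟨Finset.inter_subset_right, fun h => hBA (h.trans Finset.inter_subset_left)⟩
    obtain ⟨a, ha⟩ := Nat.exists_eq_add_of_lt h2
    obtain ⟨b, hb⟩ := Nat.exists_eq_add_of_lt h3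
    have hu := hcard (A ∪ B)
    have e1 : 2 ^ (n - A.card) = 2 ^ (b + 1) * 2 ^ (n - (A ∪ B).card) := by
      rw [← pow_add]; congr 1; omega
    have e2 : 2 ^ (n - B.card) = 2 ^ (a + 1) * 2 ^ (n - (A ∪ B).card) := by
      rw [← pow_add]; congr 1; omega
    have e3 : 2 ^ (n - (A ∩ B).card) = 2 ^ (a + 1) * 2 ^ (b + 1) * 2 ^ (n - (A ∪ B).card) := by
      rw [← pow_add, ← pow_add]; congr 1; omega
    have h4 : 0 < 2 ^ (n - (A ∪ B).card) := by positivity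
    -- With `α` and `β` at least `2`, the increase by one of the two values on the left of the
    -- submodular inequality is outweighed by the slack `(α - 1) * (β - 1) * M`.
    have h5 : 2 ^ (n - A.card) + 2 ^ (n - B.card) + 1 ≤
        2 ^ (n - (A ∩ B).card) + 2 ^ (n - (A ∪ B).card) := by
      rw [e1, e2, e3]
      have ha2 : 2 ≤ 2 ^ (a + 1) := by
        rw [pow_succ]
        have := Nat.one_le_two_pow (n := a)
        omega
      have hb2 : 2 ≤ 2 ^ (b + 1) := by
        rw [pow_succ]
        have := Nat.one_le_two_pow (n := b)
        omega
      generalize 2 ^ (a + 1) = α at *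
      generalize 2 ^ (b + 1) = β at *
      generalize 2 ^ (n - (A ∪ B).card) = M at *
      obtain ⟨α, rfl⟩ := Nat.exists_eq_add_of_le ha2
      obtain ⟨β, rfl⟩ := Nat.exists_eq_add_of_le hb2
      nlinarith [Nat.zero_le (α * β * M), Nat.zero_le (α * M), Nat.zero_le (β * M)]
    have := hval A
    have := hval B
    have := hval (A ∪ B)
    have := hval (A ∩ B)
    have := hle (A ∪ B)
    have := hle (A ∩ B)
    omega
  · have h1 := Finset.card_pos.2 (Finset.nonempty_iff_ne_empty.2 hA)
    have h2 : 2 ^ (n - A.card) < 2 ^ n :=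
      Nat.pow_lt_pow_right one_lt_two (by have := hcard A; omega)
    have := hval A
    omega

/-- The third function of the reduction: a strictly concave function of the cardinality, increased
by one at the sets whose certificate is rejected. -/
def certificateFun (V : List Bool × List Bool → Bool) (x : List Bool) (k : ℕ)
    (Y : Finset (Fin (k * 2))) : ℕ :=
  concaveVal Y.card (k * 2 - Y.card)
    (!V (x, unpad (List.ofFn fun j : Fin k => decide (pairSnd j ∈ Y))))

/-- The input that belongs to the string `x`, with `k` pairs. -/
def reductionInput (V : List Bool × List Bool → Bool) (x : List Bool) (k : ℕ) : Input :=
  pairInput k (pairWeight k) (pairWeight_pos k) (certificateFun V x k)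
    (isPositivePolymatroid_concaveVal _)

/-- The threshold for an input with `k` pairs. -/
def threshold (k : ℕ) : ℕ := 2 ^ (k + 1) * (2 ^ (2 * k) - 1)

theorem threshold_eq (k : ℕ) :
    threshold k = ∑ j, pairWeight k j + 2 * (2 ^ k * (2 ^ k - 1)) := by
  obtain ⟨a, ha⟩ : ∃ a, 2 ^ k = a + 1 := ⟨2 ^ k - 1, (Nat.sub_add_cancel Nat.one_le_two_pow).symm⟩
  have h : 2 ^ (2 * k) = (a * a + 2 * a) + 1 := by
    rw [two_mul, pow_add, ha]
    ring
  rw [sum_pairWeight, threshold, pow_succ, pow_succ, h, ha, Nat.add_sub_cancel, Nat.add_sub_cancel]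
  ring

theorem certificateFun_transversal (V : List Bool × List Bool → Bool) (x : List Bool) {k : ℕ}
    (hk : 0 < k) (r : Fin k → Bool) : certificateFun V x k (transversal r) =
      2 * (2 ^ k * (2 ^ k - 1)) + (!V (x, unpad (List.ofFn r))).toNat := by
  have h : 0 < 2 ^ k - 1 := Nat.sub_pos_of_lt (Nat.one_lt_two_pow (by omega))
  have h' : 2 ^ k * (2 ^ k - 1) ≠ 0 := by positivity
  have hk' : k * 2 - k = k := by omega
  simp only [certificateFun, card_transversal, hk', concaveVal, if_neg h', Nat.bit_val,
    pairSnd_mem_transversal, Bool.decide_eq_true]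

theorem exists_objective_le_threshold_iff (V : List Bool × List Bool → Bool) (x : List Bool) {k : ℕ}
    (hk : 0 < k) : (∃ A, (reductionInput V x k).objective A ≤ threshold k) ↔
      ∃ r : Fin k → Bool, V (x, unpad (List.ofFn r)) = true := by
  have hpow : 2 * (2 ^ k * (2 ^ k - 1)) < 2 ^ (2 * k + 1) := by
    have h1 : 2 ^ (2 * k + 1) = 2 * (2 ^ k * 2 ^ k) := by ring
    have h2 : 0 < 2 ^ k := by positivity
    rw [h1]
    exact Nat.mul_lt_mul_of_pos_left
      (Nat.mul_lt_mul_of_pos_left (Nat.sub_lt h2 one_pos) h2) two_pos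
  rw [threshold_eq]
  have hexists : ∀ A : Finset (Fin (k * 2)), ∑ j, pairWeight k j +
      (∑ j, if Respects A j then 0 else pairWeight k j) +
        certificateFun V x k (symmDiff A (firsts k)) ≤
          ∑ j, pairWeight k j + 2 * (2 ^ k * (2 ^ k - 1)) →
      ∃ r : Fin k → Bool, V (x, unpad (List.ofFn r)) = true := by
    intro A hA
    have hresp : ∀ j, Respects A j := by
      by_contra! h
      obtain ⟨j, hj⟩ := h
      have h1 := Finset.single_le_sum
        (f := fun j : Fin k => if Respects A j then 0 else pairWeight k j)
        (fun _ _ => Nat.zero_le _) (Finset.mem_univ j)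
      simp only [if_neg hj, pairWeight] at h1
      have h2 : 2 ^ (2 * k + 1) ≤ 2 ^ (2 * k + 1 + (j : ℕ)) :=
        Nat.pow_le_pow_right two_pos (Nat.le_add_right _ _)
      simp only [pairWeight] at hA
      omega
    have hsd := symmDiff_firsts_of_respects hresp
    rw [hsd, certificateFun_transversal V x hk] at hA
    refine ⟨fun j => decide (pairSnd j ∈ A), ?_⟩
    by_contra hV
    rw [Bool.not_eq_true] at hV
    simp only [hV, if_pos (hresp _), Finset.sum_const_zero, Bool.not_false, Bool.toNat_true] at hA
    omega
  constructor
  · rintro ⟨A, hA⟩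
    exact hexists A (le_of_eq_of_le (objective_pairInput (k := k) A).symm hA)
  · rintro ⟨r, hr⟩
    refine ⟨symmDiff (transversal r) (firsts k), le_of_eq ?_⟩
    refine (objective_transversal (k := k) r).trans ?_
    rw [certificateFun_transversal V x hk, hr]
    rfl

theorem exists_ofFn_eq {α : Type*} {k : ℕ} {l : List α} (h : l.length = k) :
    ∃ r : Fin k → α, List.ofFn r = l := by
  subst h
  exact ⟨l.get, List.ofFn_get l⟩

/-- Certificates of length less than `k` correspond to transversals of `k` pairs. -/
theorem exists_transversal_iff (V : List Bool × List Bool → Bool) (x : List Bool) (k : ℕ) :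
    (∃ r : Fin (k + 1) → Bool, V (x, unpad (List.ofFn r)) = true) ↔
      ∃ y : List Bool, y.length ≤ k ∧ V (x, y) = true := by
  constructor
  · rintro ⟨r, hr⟩
    refine ⟨_, (length_unpad_le _).trans ?_, hr⟩
    simp
  · rintro ⟨y, hy, hV⟩
    obtain ⟨r, hr⟩ := exists_ofFn_eq (k := k + 1)
      (l := y ++ true :: List.replicate (k - y.length) false) (by simp; omega)
    exact ⟨r, by rwa [hr, unpad_pad]⟩

theorem count_true_ofFn {n : ℕ} (f : Fin n → Bool) :
    (List.ofFn f).count true = ∑ j, (f j).toNat := by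
  induction n with
  | zero => simp
  | succ n ih =>
    rw [List.ofFn_succ, List.count_cons, ih, Fin.sum_univ_succ, Nat.add_comm]
    cases f 0 <;> simp

/-- The functions of the input have the values that the machine computes. -/
theorem f_reductionInput (V : List Bool × List Bool → Bool) (x : List Bool) (k : ℕ) (i : Fin 3)
    (Y : Finset (Fin (k * 2))) :
    (reductionInput V x k).f i Y = oracleVal V x i (pairBits Y) := by
  have hlen : (pairBits Y).length = k := by simp [pairBits]
  have h01 : touchWeight (pairWeight k) Y =
      2 ^ (2 * (pairBits Y).length + 1) * touchVal (pairBits Y) := by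
    rw [hlen, touchWeight_pairWeight]
  have hcount : (flattenPairs (pairBits Y)).count true = Y.card := by
    rw [← charVec_eq_flattenPairs, charVec, count_true_ofFn,
      Finset.sum_congr rfl (g := fun e => if e ∈ Y then 1 else 0)
        fun e _ => by by_cases h : e ∈ Y <;> simp [h]]
    simp
  have hcount' : (flattenPairs (pairBits Y)).count false = k * 2 - Y.card := by
    have h1 := List.count_true_add_count_false (flattenPairs (pairBits Y))
    rw [length_flattenPairs, hlen, hcount] at h1
    omega
  have h2 : certificateFun V x k Y = oracleVal V x 2 (pairBits Y) := by
    rw [oracleVal, if_neg (by norm_num), hcount, hcount', certificateFun, pairBits, List.map_ofFn]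
    rfl
  fin_cases i
  · exact h01
  · exact h01
  · exact h2

theorem unaryEncodeNat_eq (n : ℕ) : Computability.unaryEncodeNat n = List.replicate n true := by
  induction n with
  | zero => rfl
  | succ n ih => rw [Computability.unaryEncodeNat, ih, List.replicate_succ]

open Computability in
theorem encodeNat_iterate_bit_true (j : ℕ) :
    encodeNat ((Nat.bit true)^[j] 0) = List.replicate j true := by
  induction j with
  | zero => rfl
  | succ j ih =>
    rw [Function.iterate_succ_apply', encodeNat_bit, ih]
    simp [List.replicate_succ]

open Computability in
theorem encodeNat_iterate_bit_false (j : ℕ) {n : ℕ} (hn : n ≠ 0) :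
    encodeNat ((Nat.bit false)^[j] n) = List.replicate j false ++ encodeNat n := by
  have h : (encodeNat n).isEmpty = false := by simp [encodeNat_isEmpty, hn]
  induction j with
  | zero => rfl
  | succ j ih =>
    have h' : (List.replicate j false ++ encodeNat n).isEmpty = false := by
      rw [List.isEmpty_eq_false_iff] at h ⊢
      exact List.append_ne_nil_of_right_ne_nil _ h
    rw [Function.iterate_succ_apply', encodeNat_bit, ih, h']
    simp [List.replicate_succ]

open Computability in
theorem encodeNat_threshold {k : ℕ} (hk : 0 < k) :
    encodeNat (threshold k) = List.replicate (k + 1) false ++ List.replicate (2 * k) true := by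
  have h : 2 ^ (2 * k) - 1 ≠ 0 := Nat.sub_ne_zero_of_lt (Nat.one_lt_two_pow (by omega))
  rw [threshold, ← iterate_bit_false, encodeNat_iterate_bit_false _ h, ← iterate_bit_true,
    encodeNat_iterate_bit_true]

theorem flatten_replicate_pair {α : Type*} (k : ℕ) (a : α) :
    (List.replicate k [a, a]).flatten = List.replicate (k * 2) a := by
  induction k with
  | zero => rfl
  | succ k ih => rw [List.replicate_succ, List.flatten_cons, ih, Nat.succ_mul, Nat.add_comm,
      List.replicate_add]; rfl

theorem explicitPart_reductionInput (V : List Bool × List Bool → Bool) (x : List Bool) {k : ℕ}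
    (hk : 0 < k) : explicitPart (reductionInput V x k) (threshold k) = explicitWord k := by
  have h1 : (List.ofFn fun i => charVec ((reductionInput V x k).B i)).flatten =
      List.replicate (k * 2) false ++ (List.replicate (k * 2) true ++
        (List.replicate k [true, false]).flatten) := by
    have h2 : (List.ofFn fun i => charVec ((reductionInput V x k).B i)) =
      [charVec (∅ : Finset (Fin (k * 2))), charVec (Finset.univ : Finset (Fin (k * 2))),
        charVec (firsts k)] := rfl
    have h3 : charVec (firsts k) = (List.replicate k [true, false]).flatten := by
      rw [charVec_eq_flattenPairs]
      simp [pairBits, flattenPairs, List.flatMap_def, List.ofFn_const]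
    rw [h2, h3]
    simp [charVec, List.ofFn_const]
  have h4 : explicitPart (reductionInput V x k) (threshold k) =
      (Computability.unaryEncodeNat (k * 2)).map Sum.inl ++
      ((Computability.unaryEncodeNat 3).map Sum.inl ++
      ((List.ofFn fun i => charVec ((reductionInput V x k).B i)).flatten.map Sum.inl ++
      (Computability.encodeNat (threshold k)).map Sum.inr).map Sum.inr).map Sum.inr := rfl
  have h5 : (List.replicate k [symB true, symB false]).flatten =
      ((((List.replicate k [true, false]).flatten.map Sum.inl).map Sum.inr).map Sum.inr :
        List ExpSym) := by
    simp [List.map_flatten]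
  have h6 : (List.replicate k [symT false]).flatten = List.replicate k (symT false) := by
    simp
  rw [h4, h1, encodeNat_threshold hk, unaryEncodeNat_eq, unaryEncodeNat_eq, explicitWord, h5, h6]
  simp only [flatten_replicate_pair]
  simp [List.replicate_succ, Nat.mul_comm k 2]

open Computability in
theorem oracleProg_runs_queryString {V : List Bool × List Bool → Bool}
    (hV : TM2ComputableInPolyTime
      (encodingProd (encodingList Bool) (encodingList Bool)).encode encodeBool V)
    (x : List Bool) (k : ℕ) (i : Fin 3) (Y : Finset (Fin (k * 2))) :
    (oracleProg hV).Runs (regState false)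
      (singleStk (.inr .inp) ((queryString x i Y).map (Equiv.refl QSym).symm)) (regState false)
      (singleStk (.inr .out)
        ((encodeNat ((reductionInput V x k).f i Y)).map (Equiv.refl Bool).symm))
      ((10 * Polynomial.X + hV.time + 10).eval (queryString x i Y).length) := by
  have h := oracleProg_runs hV x i.2 (pairBits Y)
  have hq : queryString x i Y = x.map Sum.inl ++ ((encodeNat i).map Sum.inl ++
      (flattenPairs (pairBits Y)).map Sum.inr).map Sum.inr := by
    rw [← charVec_eq_flattenPairs]
    rfl
  rw [hq, Equiv.refl_symm, Equiv.refl_symm, Equiv.coe_refl, Equiv.coe_refl, List.map_id,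
    List.map_id, singleStk_inp, singleStk_out, f_reductionInput V x _ i Y]
  simpa using h

/-- SH-min is NP-hard: the certificates for membership of `x` correspond to the transversals, and
the third function of the input, which may be any function that can be evaluated, tells which
certificates are accepted. -/
theorem isNPHard : IsNPHard := by
  rintro L ⟨p, V, ⟨hV⟩, hL⟩
  refine ⟨fun x => reductionInput V x (p.eval x.length + 1), fun x => threshold (p.eval x.length + 1),
    ?_, ?_, fun x => ?_⟩
  · obtain ⟨P, T, h⟩ := exists_prog_explicitWord (p + 1)
    refine Prog.nonempty_computable P none (k₀ := .x) (k₁ := .out) (Equiv.refl Bool)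
      (Equiv.refl ExpSym) T fun x => ?_
    have h' := h x
    rw [Polynomial.eval_add, Polynomial.eval_one,
      ← explicitPart_reductionInput V x (k := p.eval x.length + 1) (Nat.succ_pos _)] at h'
    simpa using h'
  · have := hV.tm.kFin
    have := hV.tm.σFin
    exact Prog.nonempty_computable (oracleProg hV) (regState false) (k₀ := .inr .inp)
      (k₁ := .inr .out) (Equiv.refl QSym) (Equiv.refl Bool) (10 * Polynomial.X + hV.time + 10)
      fun q => oracleProg_runs_queryString hV q.1 (p.eval q.1.length + 1) q.2.1 q.2.2
  · rw [hL, exists_objective_le_threshold_iff V x (Nat.succ_pos _), exists_transversal_iff]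

end Machines

end SHMin

theorem mainTheorem2 :
    SHMin.IsNPHard ∧
    ∀ α : ℝ, α < 4 / 3 → ∀ p : ℝ, 0 < p →
      ¬ ∃ alg : SHMin.Algorithm, alg.PolynomiallyManyQueries ∧ alg.Approximates α p :=
  ⟨SHMin.isNPHard, fun _ hα _ hp ⟨alg, hq, ha⟩ => SHMin.not_approximates hα hp alg hq ha⟩
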